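/- \textbf{Conventions.} Let $X$ be a finite set of features. An \emph{entity} is a function $\mathbf e:X\to\{0,1\}$. A \emph{Boolean circuit} $C$ over $X$ is a finite directed acyclic graph in which the nodes (gates) without incoming edges are labelled by a variable of $X$ or a constant $0$ or $1$, the nodes with incoming edges are labelled $\land$, $\lor$ or $\lnot$ (fan-in is unbounded for $\land$ and $\lor$, and exactly $1$ for $\lnot$), and exactly one node, the output gate, has no outgoing edge; $C(\mathbf e)\in\{0,1\}$ is the value of the output gate on $\mathbf e$. For a gate $g$ let $C_g$ be the subcircuit consisting of the gates from which there is a path to $g$, and $\mathrm{var}(g)$ the set of variables that label a gate of $C_g$. The circuit is \emph{deterministic} if for every $\lor$-gate and any two distinct input gates $g_1,g_2$ of it, no entity is accepted by both $C_{g_1}$ and $C_{g_2}$, and \emph{decomposable} if for every $\land$-gate and any two distinct input gates $g_1,g_2$ of it, $\mathrm{var}(g_1)\cap\mathrm{var}(g_2)=\emptyset$. For $\mathrm p:X\to[0,1]$ let $\Pi_{\mathrm p}$ be the product distribution on entities, $\Pi_{\mathrm p}(\mathbf e)=\prod_{\mathbf e(y)=1}\mathrm p(y)\prod_{\mathbf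 e(y)=0}(1-\mathrm p(y))$. For $S\subseteq X$ let $\mathsf{cw}(\mathbf e,S)$ be the set of entities that agree with $\mathbf e$ on $S$, and $$\phi(C,\mathbf e,S)=\mathbb E_{\mathbf e'\sim\Pi_{\mathrm p}}\big[C(\mathbf e')\mid \mathbf e'\in\mathsf{cw}(\mathbf e,S)\big],$$ where, if $\Pi_{\mathrm p}(\mathsf{cw}(\mathbf e,S))=0$, the conditional law is understood to be the product distribution obtained from $\Pi_{\mathrm p}$ by fixing the features in $S$ to their values in $\mathbf e$. The SHAP-score of $x\in X$ under $\Pi_{\mathrm p}$ is $$\mathsf{SHAP}(C,\mathbf e,x)=\sum_{S\subseteq X\setminus\{x\}}\frac{|S|!\,(|X|-|S|-1)!}{|X|!}\Big(\phi(C,\mathbf e,S\cup\{x\})-\phi(C,\mathbf e,S)\Big).$$ \textbf{Theorem.} The following problem can be solved in polynomial time (on a random-access machine under the logarithmic cost criterion, in the total binary length of the input). Given as input a deterministic and decomposable Boolean circuit $C$ over a finite set of features $X$, rational probability values $\mathrm p(y)\in[0,1]$ for all $y\in X$, an entity $\mathbf e:X\to\{0,1\}$ and a feature $x\in X$, compute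 the rational number $\mathsf{SHAP}(C,\mathbf e,x)$ under the distribution $\Pi_{\mathrm p}$ (as a fraction in lowest terms). -/

import Mathlib

/-! ## Boolean circuits -/

/-- Labels of the gates of a Boolean circuit over the set of variables `X`. -/
inductive GateLabel (X : Type*) where
  | var (x : X)
  | const (b : Bool)
  | and
  | or
  | not

/-- Variable gates and constant gates. -/
def GateLabel.IsInput {X : Type*} : GateLabel X → Prop
  | .var _ => True
  | .const _ => True
  | _ => False

/-- A Boolean circuit over the variables `X`, with set of gates `G`: a directed acyclic graph
(`wire g' g = true` means that there is an edge from `g'` to `g`, i.e. `g'` is an input gate of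
`g`) with labelled nodes.  The fan-in of `and`- and `or`-gates is unbounded, and the gates are
not assumed to be listed in any particular order. -/
structure BooleanCircuit (X G : Type*) where
  label : G → GateLabel X
  wire : G → G → Bool
  acyclic : ∀ g, ¬ Relation.TransGen (fun a b => wire a b = true) g g
  /-- nodes without incoming edges are variable or constant gates -/
  source_isInput : ∀ g, (∀ g', wire g' g = false) → (label g).IsInput
  /-- nodes with incoming edges are logic gates -/
  logic_of_wire : ∀ g g', wire g' g = true → ¬ (label g).IsInput
  /-- a negation gate has exactly one incoming edge -/
  fanin_not : ∀ g, label g = .not → ∃! g', wire g' g = true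
  /-- exactly one node has no outgoing edge -/
  unique_output : ∃! g, ∀ g', wire g g' = false

namespace BooleanCircuit

variable {X G : Type*}

theorem wellFounded_wire [Finite G] (C : BooleanCircuit X G) :
    WellFounded (fun a b => C.wire a b = true) := by
  have h : WellFounded (Relation.TransGen (fun a b => C.wire a b = true)) := by
    have : Std.Irrefl (Relation.TransGen (fun a b => C.wire a b = true)) := ⟨C.acyclic⟩
    have : IsTrans G (Relation.TransGen (fun a b => C.wire a b = true)) :=
      ⟨fun _ _ _ => Relation.TransGen.trans⟩
    exact Finite.wellFounded_of_trans_of_irrefl _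
  exact h.mono fun _ _ hab => Relation.TransGen.single hab

open Classical in
/-- The value of gate `g` when the circuit is evaluated over the entity `e`. -/
noncomputable def eval [Finite G] (C : BooleanCircuit X G) (e : X → Bool) : G → Bool :=
  C.wellFounded_wire.fix fun g val =>
    match C.label g with
    | .var x => e x
    | .const b => b
    | .and => decide (∀ g' (h : C.wire g' g = true), val g' h = true)
    | .or => decide (∃ g', ∃ h : C.wire g' g = true, val g' h = true)
    | .not => decide (∀ g' (h : C.wire g' g = true), val g' h = false)

open Classical in
theorem eval_eq [Finite G] (C : BooleanCircuit X G) (e : X → Bool) (g : G) :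
    C.eval e g =
      match C.label g with
      | .var x => e x
      | .const b => b
      | .and => decide (∀ g', C.wire g' g = true → C.eval e g' = true)
      | .or => decide (∃ g', C.wire g' g = true ∧ C.eval e g' = true)
      | .not => decide (∀ g', C.wire g' g = true → C.eval e g' = false) := by
  rw [eval, WellFounded.fix_eq]
  cases C.label g <;> simp

/-- The output gate: the unique node without outgoing edges. -/
noncomputable def output (C : BooleanCircuit X G) : G := C.unique_output.choose

/-- The Boolean classifier represented by the circuit. -/
noncomputable def classifier [Finite G] (C : BooleanCircuit X G) (e : X → Bool) : Bool :=
  C.eval e C.output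

/-- `var(g)`: the variables labelling a variable gate from which there is a path to `g`. -/
def vars (C : BooleanCircuit X G) (g : G) : Set X :=
  {x | ∃ g', Relation.ReflTransGen (fun a b => C.wire a b = true) g' g ∧ C.label g' = .var x}

/-- Every `or`-gate is deterministic: no entity is accepted by two distinct input gates of it.
(The value of the subcircuit rooted at a gate is the value of that gate.) -/
def Deterministic [Finite G] (C : BooleanCircuit X G) : Prop :=
  ∀ g, C.label g = .or → ∀ g₁ g₂, C.wire g₁ g = true → C.wire g₂ g = true → g₁ ≠ g₂ →
    ¬ ∃ e : X → Bool, C.eval e g₁ = true ∧ C.eval e g₂ = true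

/-- Every `and`-gate is decomposable: two distinct input gates of it share no variable. -/
def Decomposable (C : BooleanCircuit X G) : Prop :=
  ∀ g, C.label g = .and → ∀ g₁ g₂, C.wire g₁ g = true → C.wire g₂ g = true → g₁ ≠ g₂ →
    C.vars g₁ ∩ C.vars g₂ = ∅

end BooleanCircuit

/-! ## The SHAP-score under a product distribution -/

section Shap

variable {X : Type*} [Fintype X] [DecidableEq X]

/-- The product distribution on entities in which each feature `y` independently takes the
value `1` with probability `p y`. -/
def productDistribution (p : X → ℚ) (e : X → Bool) : ℚ :=
  (∏ y with e y = true, p y) * (∏ y with e y = false, (1 - p y))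

/-- `cw(e, S)`: the entities that coincide with `e` on `S`. -/
def consistentWith (e : X → Bool) (S : Finset X) : Finset (X → Bool) :=
  {e' | ∀ y ∈ S, e' y = e y}

/-- The marginals `p`, with those of the features in `S` replaced by the values of `e`. -/
def fixMarginals (p : X → ℚ) (e : X → Bool) (S : Finset X) (y : X) : ℚ :=
  if y ∈ S then (if e y = true then 1 else 0) else p y

/-- `φ(M, e, S)`: the conditional expectation of `M e'` given `e' ∈ cw(e, S)`, for `e'` drawn
from the product distribution generated by `p`.  If the event `cw(e, S)` is null (possible only
when some `p y` with `y ∈ S` is `0` or `1`), the conditional law is taken, as usual for independent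
features, to fix the features in `S` to `e` and to leave the law of the others unchanged. -/
def condExpectation (p : X → ℚ) (M : (X → Bool) → Bool) (e : X → Bool) (S : Finset X) : ℚ :=
  if ∑ e' ∈ consistentWith e S, productDistribution p e' ≠ 0 then
    (∑ e' ∈ consistentWith e S, productDistribution p e' * (if M e' = true then 1 else 0)) /
      ∑ e' ∈ consistentWith e S, productDistribution p e'
  else
    ∑ e', productDistribution (fixMarginals p e S) e' * (if M e' = true then 1 else 0)

/-- The SHAP-score of the feature `x` on the entity `e` with respect to the classifier `M`,
under the product distribution generated by `p`. -/
def shapScore (p : X → ℚ) (M : (X → Bool) → Bool) (e : X → Bool) (x : X) : ℚ :=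
  ∑ S ∈ (Finset.univ.erase x).powerset,
    ((Nat.factorial S.card : ℚ) * (Nat.factorial (Fintype.card X - S.card - 1) : ℚ)
        / (Nat.factorial (Fintype.card X) : ℚ))
      * (condExpectation p M e (insert x S) - condExpectation p M e S)

end Shap

/-! ## Random-access machines with logarithmic cost, and polynomial time

The memory consists of arrays named by natural numbers, each cell `(k, i)` of which holds a natural
number; a program mentions finitely many arrays, and may address their cells indirectly.  As usual
for the logarithmic cost criterion, every operation is charged the number of binary digits of all
of its operands (addresses included). -/

/-- A memory: `σ k i` is the content of cell `i` of array `k`. -/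
abbrev RamMemory := ℕ → ℕ → ℕ

/-- Arithmetic expressions of random-access machine programs. -/
inductive RamExpr where
  | lit (c : ℕ)
  | read (k : ℕ) (i : RamExpr)
  | add (a b : RamExpr)
  | sub (a b : RamExpr)
  | mul (a b : RamExpr)
  | div (a b : RamExpr)

namespace RamExpr

/-- Value of an expression; subtraction is truncated at zero and division is the integer
quotient (zero for the divisor zero). -/
def value (σ : RamMemory) : RamExpr → ℕ
  | lit c => c
  | read k i => σ k (i.value σ)
  | add a b => a.value σ + b.value σ
  | sub a b => a.value σ - b.value σ
  | mul a b => a.value σ * b.value σ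
  | div a b => a.value σ / b.value σ

/-- Logarithmic cost of evaluating an expression (`Nat.size` is the length in binary). -/
def cost (σ : RamMemory) : RamExpr → ℕ
  | lit c => Nat.size c + 1
  | read k i => i.cost σ + Nat.size (i.value σ) + Nat.size (σ k (i.value σ)) + 1
  | add a b => a.cost σ + b.cost σ + Nat.size (a.value σ) + Nat.size (b.value σ) + 1
  | sub a b => a.cost σ + b.cost σ + Nat.size (a.value σ) + Nat.size (b.value σ) + 1
  | mul a b => a.cost σ + b.cost σ + Nat.size (a.value σ) + Nat.size (b.value σ) + 1
  | div a b => a.cost σ + b.cost σ + Nat.size (a.value σ) + Nat.size (b.value σ) + 1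

end RamExpr

/-- Random-access machine programs. -/
inductive RamProg where
  | skip
  /-- store the value of `a` in the cell of array `k` whose address is the value of `i` -/
  | write (k : ℕ) (i a : RamExpr)
  | seq (c d : RamProg)
  /-- run `c` if the value of `a` is nonzero, and `d` otherwise -/
  | branch (a : RamExpr) (c d : RamProg)
  /-- run `c` as long as the value of `a` is nonzero -/
  | loop (a : RamExpr) (c : RamProg)

/-- `RamExec c σ τ t`: started in memory `σ`, the program `c` halts in memory `τ`, at
logarithmic cost `t`. -/
inductive RamExec : RamProg → RamMemory → RamMemory → ℕ → Prop where
  | skip (σ : RamMemory) : RamExec .skip σ σ 1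
  | write (k : ℕ) (i a : RamExpr) (σ : RamMemory) :
      RamExec (.write k i a) σ
        (Function.update σ k (Function.update (σ k) (i.value σ) (a.value σ)))
        (i.cost σ + a.cost σ + Nat.size (i.value σ) + Nat.size (a.value σ) + 1)
  | seq {c d : RamProg} {σ τ υ : RamMemory} {s t : ℕ} :
      RamExec c σ τ s → RamExec d τ υ t → RamExec (.seq c d) σ υ (s + t)
  | branch_true {a : RamExpr} {c d : RamProg} {σ τ : RamMemory} {t : ℕ} :
      a.value σ ≠ 0 → RamExec c σ τ t → RamExec (.branch a c d) σ τ (a.cost σ + 1 + t)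
  | branch_false {a : RamExpr} {c d : RamProg} {σ τ : RamMemory} {t : ℕ} :
      a.value σ = 0 → RamExec d σ τ t → RamExec (.branch a c d) σ τ (a.cost σ + 1 + t)
  | loop_done {a : RamExpr} {c : RamProg} {σ : RamMemory} :
      a.value σ = 0 → RamExec (.loop a c) σ σ (a.cost σ + 1)
  | loop_step {a : RamExpr} {c : RamProg} {σ τ υ : RamMemory} {s t : ℕ} :
      a.value σ ≠ 0 → RamExec c σ τ s → RamExec (.loop a c) τ υ t →
        RamExec (.loop a c) σ υ (a.cost σ + 1 + s + t)

/-- The initial memory on input `l`: array `0` holds the length of `l` followed by the entries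
of `l`, and all other cells hold `0`. -/
def ramInput (l : List ℕ) : RamMemory :=
  fun k i => if k = 0 then (l.length :: l).getD i 0 else 0

/-- The memory `σ` presents the output `l`: array `1` starts with the length of `l` followed by
the entries of `l`. -/
def RamOutput (σ : RamMemory) (l : List ℕ) : Prop :=
  ∀ i ≤ l.length, σ 1 i = (l.length :: l).getD i 0

/-- The length of an input: the total number of binary digits (plus one separator per entry). -/
def inputLength (l : List ℕ) : ℕ := (l.map fun a => Nat.size a + 1).sum

/-- Given encodings of inputs and outputs by lists of natural numbers, the problem
"given an instance `a ∈ D`, compute `f a`" can be solved in polynomial time. -/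
def PolyTimeComputableOn {α β : Type*} (encIn : α → List ℕ) (encOut : β → List ℕ)
    (D : Set α) (f : α → β) : Prop :=
  ∃ (prog : RamProg) (P : Polynomial ℕ), ∀ a ∈ D, ∃ (τ : RamMemory) (t : ℕ),
    RamExec prog (ramInput (encIn a)) τ t ∧ t ≤ P.eval (inputLength (encIn a)) ∧
      RamOutput τ (encOut (f a))

/-! ## Inputs and outputs of the problem -/

/-- A rational number, by its sign and its numerator and denominator in lowest terms. -/
def encodeRat (q : ℚ) : List ℕ := [if q < 0 then 1 else 0, q.num.natAbs, q.den]

/-- Input data: a circuit (with features `0, …, n - 1` and gates `0, …, m - 1`), rational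
marginals, an entity, and a feature. -/
structure ShapInput where
  n : ℕ
  m : ℕ
  C : BooleanCircuit (Fin n) (Fin m)
  p : Fin n → ℚ
  e : Fin n → Bool
  x : Fin n

def GateLabel.encode {n : ℕ} : GateLabel (Fin n) → List ℕ
  | .var x => [0, x]
  | .const b => [1, b.toNat]
  | .and => [2, 0]
  | .or => [3, 0]
  | .not => [4, 0]

/-- The number of features, the number of gates, the gate labels, the adjacency matrix (row by
row), the marginals, the entity, and the feature. -/
def ShapInput.encode (I : ShapInput) : List ℕ :=
  [I.n, I.m]
    ++ (List.finRange I.m).flatMap (fun g => (I.C.label g).encode)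
    ++ (List.finRange I.m).flatMap
        (fun g => (List.finRange I.m).map fun g' => (I.C.wire g g').toNat)
    ++ (List.finRange I.n).flatMap (fun y => encodeRat (I.p y))
    ++ (List.finRange I.n).map (fun y => (I.e y).toNat)
    ++ [(I.x : ℕ)]

/-- The legal instances: the circuit is deterministic and decomposable, and every marginal is a
probability. -/
def shapInstances : Set ShapInput :=
  {I | I.C.Deterministic ∧ I.C.Decomposable ∧ ∀ y, 0 ≤ I.p y ∧ I.p y ≤ 1}

/-- The requested value. -/
noncomputable def ShapInput.score (I : ShapInput) : ℚ :=
  shapScore I.p I.C.classifier I.e I.x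

/-!
Multiplying all probabilities by a common denominator turns the conditional expectation for a set
`S` of fixed features into an integral weighted count of the accepted entities. The SHAP-score only
needs, for each `k`, the sums of these counts over the sets `S` of size `k` without `x`, and over
the same sets with `x` added. All of them are read off a single weighted count: give every value of
`y` its probability weight plus `z y` times the indicator weight of the entity, and expand the
product. With `z y = B` for `y ≠ x` and `z x = B ^ n`, where `B` exceeds all the sums, these are the
digits in base `B` of the count.

For fixed weights the counts of all gates follow from those of their inputs. With `T` the total
weight, negation is subtraction from `T`, disjunction is addition by determinism, and a conjunction
of `k` gates satisfies `count * T ^ k = T * ∏ counts` by decomposability. The machine recomputes all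
gates in `m` rounds; after `r` of them the gates of rank below `r` are correct, so no topological
order is needed. All numbers involved have polynomially many digits.
-/

/-! ## Weighted model counting -/

section WeightedCount

variable {X : Type*} [Fintype X] [DecidableEq X] {R : Type*} [CommSemiring R]

/-- Weighted model count of a Boolean function: the weight of an entity is the product of the
weights `w y b` of its values, and the weights of the accepted entities are added up. -/
def weightedCount (w : X → Bool → R) (f : (X → Bool) → Bool) : R :=
  ∑ u with f u = true, ∏ y, w y (u y)

/-- The weighted count of the constant function `true`, in product form. -/
def totalWeight (w : X → Bool → R) : R := ∏ y, (w y true + w y false)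

theorem sum_prod_apply_eq_totalWeight (w : X → Bool → R) :
    ∑ u : X → Bool, ∏ y, w y (u y) = totalWeight w := by
  simp [← Fintype.prod_sum, totalWeight]

theorem weightedCount_true (w : X → Bool → R) :
    weightedCount w (fun _ => true) = totalWeight w := by
  simp [weightedCount, sum_prod_apply_eq_totalWeight]

theorem weightedCount_false (w : X → Bool → R) : weightedCount w (fun _ => false) = 0 := by
  simp [weightedCount]

theorem weightedCount_or (w : X → Bool → R) {f g : (X → Bool) → Bool}
    (h : ∀ u, ¬ (f u = true ∧ g u = true)) :
    weightedCount w (fun u => f u || g u) = weightedCount w f + weightedCount w g := by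
  simp only [weightedCount, Bool.or_eq_true, Finset.filter_or]
  exact Finset.sum_union (Finset.disjoint_filter.2 fun u _ hf hg => h u ⟨hf, hg⟩)

theorem weightedCount_not_add (w : X → Bool → R) (f : (X → Bool) → Bool) :
    weightedCount w (fun u => !f u) + weightedCount w f = totalWeight w := by
  rw [← weightedCount_or w (by simp), ← weightedCount_true]
  simp

theorem weightedCount_le_totalWeight (w : X → Bool → ℕ) (f : (X → Bool) → Bool) :
    weightedCount w f ≤ totalWeight w :=
  weightedCount_not_add w f ▸ Nat.le_add_left _ _

theorem weightedCount_mul_left (c : X → R) (w : X → Bool → R) (f : (X → Bool) → Bool) :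
    weightedCount (fun y b => c y * w y b) f = (∏ y, c y) * weightedCount w f := by
  simp only [weightedCount, Finset.prod_mul_distrib, Finset.mul_sum]

theorem natCast_weightedCount (w : X → Bool → ℕ) (f : (X → Bool) → Bool) :
    ((weightedCount w f : ℕ) : R) = weightedCount (fun y b => (w y b : R)) f := by
  simp [weightedCount]

/-- Expanding the product of the sums `a y b * z y + c y b` selects, for each entity, the set of
features that contribute their first summand. -/
theorem weightedCount_mul_add (a c : X → Bool → R) (z : X → R) (f : (X → Bool) → Bool) :
    weightedCount (fun y b => a y b * z y + c y b) f =
      ∑ S : Finset X,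
        (∏ y ∈ S, z y) * weightedCount (fun y b => if y ∈ S then a y b else c y b) f := by
  simp only [weightedCount, Finset.prod_add, Finset.mul_sum]
  rw [Finset.sum_comm, Finset.powerset_univ]
  refine Finset.sum_congr rfl fun S _ => Finset.sum_congr rfl fun u _ => ?_
  rw [Finset.prod_ite, Finset.prod_mul_distrib]
  simp only [Finset.filter_mem_eq_inter, Finset.univ_inter, Finset.filter_notMem_eq_sdiff]
  ring

theorem weightedCount_apply_mul (w : X → Bool → R) (x : X) :
    weightedCount w (fun u => u x) * (w x true + w x false) = totalWeight w * w x true := by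
  let v : X → Bool → R := fun y b => if y = x ∧ b = false then 0 else w y b
  have hv : weightedCount w (fun u => u x) = totalWeight v := by
    rw [← sum_prod_apply_eq_totalWeight, weightedCount, Finset.sum_filter]
    refine Finset.sum_congr rfl fun u _ => ?_
    cases hu : u x
    · simpa using (Finset.prod_eq_zero (Finset.mem_univ x) (by simp [v, hu])).symm
    · rw [if_pos rfl]
      refine Finset.prod_congr rfl fun y _ => (if_neg ?_).symm
      rintro ⟨rfl, h⟩
      simp [hu] at h
  have herase : ∏ y ∈ Finset.univ.erase x, (v y true + v y false) =
      ∏ y ∈ Finset.univ.erase x, (w y true + w y false) :=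
    Finset.prod_congr rfl fun y hy => by simp [v, Finset.ne_of_mem_erase hy]
  rw [hv, totalWeight, totalWeight, ← Finset.mul_prod_erase _ _ (Finset.mem_univ x),
    ← Finset.mul_prod_erase _ (fun y => w y true + w y false) (Finset.mem_univ x), herase]
  simp only [v, Bool.true_eq_false, and_false, if_false, and_self, if_true, add_zero]
  ring

/-- The value of `f` is determined by the features in `A`. -/
def DependsOnlyOn {X : Type*} (f : (X → Bool) → Bool) (A : Set X) : Prop :=
  ∀ u v, (∀ y ∈ A, u y = v y) → f u = f v

open Classical in
/-- Exchanging the values at the features in `A` between two entities is a weight-preserving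
bijection from the pairs with `f ∧ g` accepting the first entity to the pairs with `f` accepting
the first and `g` the second. -/
theorem weightedCount_and_mul_totalWeight (w : X → Bool → R) {f g : (X → Bool) → Bool} {A B : Set X}
    (hf : DependsOnlyOn f A) (hg : DependsOnlyOn g B) (hAB : Disjoint A B) :
    weightedCount w (fun u => f u && g u) * totalWeight w =
      weightedCount w f * weightedCount w g := by
  let swap : (X → Bool) × (X → Bool) → (X → Bool) × (X → Bool) := fun q =>
    (fun y => if y ∈ A then q.1 y else q.2 y, fun y => if y ∈ A then q.2 y else q.1 y)
  have swap_swap : ∀ q, swap (swap q) = q := fun q => by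
    ext y <;> by_cases hy : y ∈ A <;> simp [swap, hy]
  have hfswap : ∀ q, f (swap q).1 = f q.1 := fun q => hf _ _ fun y hy => by simp [swap, hy]
  have hgswap : ∀ q, g (swap q).2 = g q.1 := fun q => hg _ _ fun y hy => by
    simp [swap, Set.disjoint_right.1 hAB hy]
  have hweight : ∀ q : (X → Bool) × (X → Bool),
      (∏ y, w y ((swap q).1 y)) * ∏ y, w y ((swap q).2 y) =
        (∏ y, w y (q.1 y)) * ∏ y, w y (q.2 y) := fun q => by
    simp only [← Finset.prod_mul_distrib]
    refine Finset.prod_congr rfl fun y _ => ?_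
    by_cases hy : y ∈ A <;> simp [swap, hy, mul_comm]
  simp only [← weightedCount_true, weightedCount, Finset.sum_mul_sum, ← Finset.sum_product']
  refine Finset.sum_nbij' swap swap ?_ ?_ (fun q _ => swap_swap q) (fun q _ => swap_swap q)
    fun q _ => (hweight q).symm
  · simp +contextual [hfswap, hgswap]
  · rintro q hq
    have := hfswap (swap q)
    have := hgswap (swap q)
    simp_all

end WeightedCount

namespace BooleanCircuit

variable {X G : Type*}

theorem vars_subset_of_wire (C : BooleanCircuit X G) {h g : G} (hw : C.wire h g = true) :
    C.vars h ⊆ C.vars g := fun _ ⟨k, hk, hx⟩ => ⟨k, hk.tail hw, hx⟩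

theorem dependsOnlyOn_eval [Finite G] (C : BooleanCircuit X G) (g : G) :
    DependsOnlyOn (fun u => C.eval u g) (C.vars g) := by
  induction g using C.wellFounded_wire.induction with
  | _ g ih =>
  intro u v huv
  have hinputs : ∀ h, C.wire h g = true → C.eval u h = C.eval v h := fun h hw =>
    ih h hw u v fun y hy => huv y (C.vars_subset_of_wire hw hy)
  simp only [eval_eq C _ g]
  cases hl : C.label g with
  | var x => exact huv x ⟨g, .refl, hl⟩
  | const b => rfl
  | and => exact decide_eq_decide.2 (forall₂_congr fun h hw => by rw [hinputs h hw])
  | or =>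
    exact decide_eq_decide.2 (exists_congr fun h => and_congr_right fun hw => by rw [hinputs h hw])
  | not => exact decide_eq_decide.2 (forall₂_congr fun h hw => by rw [hinputs h hw])

section Counting

variable [Finite G] (C : BooleanCircuit X G)

/-- Acceptance of an entity by all gates in `s`. -/
noncomputable def conj (s : Finset G) (u : X → Bool) : Bool := decide (∀ h ∈ s, C.eval u h = true)

/-- Acceptance of an entity by some gate in `s`. -/
noncomputable def disj (s : Finset G) (u : X → Bool) : Bool := decide (∃ h ∈ s, C.eval u h = true)

theorem dependsOnlyOn_conj (s : Finset G) : DependsOnlyOn (C.conj s) (⋃ h ∈ s, C.vars h) :=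
  fun u v huv => decide_eq_decide.2 (forall₂_congr fun h hs => by
    have heval : C.eval u h = C.eval v h :=
      C.dependsOnlyOn_eval h u v fun y hy => huv y (Set.mem_biUnion hs hy)
    rw [heval])

variable [Fintype X] [DecidableEq X] {R : Type*} [CommSemiring R] (w : X → Bool → R)

/-- The weighted count of the function computed at the gate `g`. -/
noncomputable def gateCount (g : G) : R := weightedCount w fun u => C.eval u g

theorem weightedCount_conj_mul_pow {s : Finset G} (hs : (s : Set G).PairwiseDisjoint C.vars) :
    weightedCount w (C.conj s) * totalWeight w ^ s.card =
      totalWeight w * ∏ h ∈ s, C.gateCount w h := by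
  induction s using Finset.cons_induction with
  | empty =>
    have hconj : C.conj ∅ = fun _ => true := by
      funext u
      simp [conj]
    simp [hconj, weightedCount_true]
  | cons g s hg ih =>
    rw [Finset.coe_cons, Set.pairwiseDisjoint_insert_of_notMem (by simpa using hg)] at hs
    have hconj : C.conj (s.cons g hg) = fun u => C.eval u g && C.conj s u := by
      funext u
      simp [conj]
    have hdisj : Disjoint (C.vars g) (⋃ h ∈ s, C.vars h) := by simpa using hs.2
    rw [Finset.card_cons, Finset.prod_cons, pow_succ', ← mul_assoc, hconj,
      weightedCount_and_mul_totalWeight w (C.dependsOnlyOn_eval g) (C.dependsOnlyOn_conj s) hdisj,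
      mul_assoc, ih hs.1, gateCount]
    ring

theorem weightedCount_disj {s : Finset G}
    (hs : (s : Set G).Pairwise fun g h => ¬ ∃ u, C.eval u g = true ∧ C.eval u h = true) :
    weightedCount w (C.disj s) = ∑ h ∈ s, C.gateCount w h := by
  induction s using Finset.cons_induction with
  | empty =>
    have hdisj : C.disj ∅ = fun _ => false := by
      funext u
      simp [disj]
    simp [hdisj, weightedCount_false]
  | cons g s hg ih =>
    have hdisj : C.disj (s.cons g hg) = fun u => C.eval u g || C.disj s u := by
      funext u
      simp [disj]
    rw [Finset.sum_cons, ← ih (hs.mono (by simp)), hdisj, weightedCount_or, gateCount]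
    rintro u ⟨hgu, hsu⟩
    obtain ⟨h, hh, hhu⟩ := of_decide_eq_true hsu
    exact hs (by simp) (by simp [hh]) (ne_of_mem_of_not_mem hh hg).symm ⟨u, hgu, hhu⟩

end Counting

section Inputs

variable [Fintype G] (C : BooleanCircuit X G)

/-- The input gates of the gate `g`. -/
def inputs (g : G) : Finset G := {h | C.wire h g = true}

theorem mem_inputs {g h : G} : h ∈ C.inputs g ↔ C.wire h g = true := by simp [inputs]

theorem eval_and {g : G} (hg : C.label g = .and) : (fun u => C.eval u g) = C.conj (C.inputs g) := by
  funext u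
  rw [eval_eq, hg]
  simp [conj, mem_inputs]

theorem eval_or {g : G} (hg : C.label g = .or) : (fun u => C.eval u g) = C.disj (C.inputs g) := by
  funext u
  rw [eval_eq, hg]
  simp [disj, mem_inputs]

theorem eval_not {g : G} (hg : C.label g = .not) :
    (fun u => C.eval u g) = fun u => !C.disj (C.inputs g) u := by
  funext u
  rw [eval_eq, hg]
  simp [disj, mem_inputs, ← decide_not]

theorem inputs_subsingleton {g : G} (hg : C.label g = .not) :
    (C.inputs g : Set G).Subsingleton := fun _ hh _ hk =>
  (C.fanin_not g hg).unique (C.mem_inputs.1 hh) (C.mem_inputs.1 hk)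

theorem sum_toNat_wire_eq_zero_iff (g : G) : ∑ h, (C.wire g h).toNat = 0 ↔ g = C.output := by
  have hzero : ∑ h, (C.wire g h).toNat = 0 ↔ ∀ h, C.wire g h = false := by simp
  rw [hzero]
  exact ⟨fun hg => C.unique_output.unique hg C.unique_output.choose_spec.1,
    fun hg => hg ▸ C.unique_output.choose_spec.1⟩

variable [Fintype X] (w : X → Bool → ℕ)

/-- The count of the gate `g` under the weights `w`, computed from candidates `c` for the counts
of its input gates. -/
def updatedCount (c : G → ℕ) (g : G) : ℕ :=
  match C.label g with
  | .var x => totalWeight w * w x true / (w x true + w x false)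
  | .const b => totalWeight w * b.toNat
  | .and => totalWeight w * (∏ h ∈ C.inputs g, c h) / totalWeight w ^ (C.inputs g).card
  | .or => min (totalWeight w) (∑ h ∈ C.inputs g, c h)
  | .not => totalWeight w - ∑ h ∈ C.inputs g, c h

theorem updatedCount_le {c : G → ℕ} (hc : ∀ h, c h ≤ totalWeight w) (g : G) :
    C.updatedCount w c g ≤ totalWeight w := by
  unfold updatedCount
  cases C.label g with
  | var x => exact Nat.div_le_of_le_mul (by nlinarith)
  | const b => cases b <;> simp
  | and =>
    refine Nat.div_le_of_le_mul ?_
    rw [mul_comm]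
    exact Nat.mul_le_mul_right _ (Finset.prod_le_pow_card _ _ _ fun h _ => hc h)
  | or => exact min_le_left _ _
  | not => exact Nat.sub_le _ _

variable [DecidableEq X] {w}

theorem updatedCount_eq_gateCount (hdet : C.Deterministic) (hdec : C.Decomposable)
    (hw : ∀ y, 0 < w y true + w y false) {c : G → ℕ} {g : G}
    (hc : ∀ h, C.wire h g = true → c h = C.gateCount w h) :
    C.updatedCount w c g = C.gateCount w g := by
  have hT : 0 < totalWeight w := Finset.prod_pos fun y _ => hw y
  have hsum : ∑ h ∈ C.inputs g, c h = ∑ h ∈ C.inputs g, C.gateCount w h :=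
    Finset.sum_congr rfl fun h hh => hc h (C.mem_inputs.1 hh)
  have hprod : ∏ h ∈ C.inputs g, c h = ∏ h ∈ C.inputs g, C.gateCount w h :=
    Finset.prod_congr rfl fun h hh => hc h (C.mem_inputs.1 hh)
  rw [updatedCount, hsum, hprod, gateCount]
  cases hg : C.label g with
  | var x =>
    have heval : (fun u => C.eval u g) = fun u => u x := by
      funext u
      rw [eval_eq, hg]
    rw [heval]
    exact Nat.div_eq_of_eq_mul_left (hw x) (weightedCount_apply_mul w x).symm
  | const b =>
    have heval : (fun u => C.eval u g) = fun _ => b := by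
      funext u
      rw [eval_eq, hg]
    rw [heval]
    cases b <;> simp [weightedCount_true, weightedCount_false]
  | and =>
    rw [C.eval_and hg]
    refine Nat.div_eq_of_eq_mul_left (pow_pos hT _)
      (C.weightedCount_conj_mul_pow w fun h hh k hk hne => ?_).symm
    exact Set.disjoint_iff_inter_eq_empty.2
      (hdec g hg h k (C.mem_inputs.1 hh) (C.mem_inputs.1 hk) hne)
  | or =>
    have hdisj := C.weightedCount_disj w (s := C.inputs g) fun h hh k hk =>
      hdet g hg h k (C.mem_inputs.1 hh) (C.mem_inputs.1 hk)
    rw [C.eval_or hg, ← hdisj]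
    exact min_eq_right (weightedCount_le_totalWeight w _)
  | not =>
    rw [C.eval_not hg, ← C.weightedCount_disj w ((C.inputs_subsingleton hg).pairwise _),
      ← weightedCount_not_add w (C.disj (C.inputs g)), Nat.add_sub_cancel]

end Inputs

section Rank

variable [Finite G] (C : BooleanCircuit X G)

/-- The number of gates from which there is a nonempty path to `g`; the gates can be evaluated in
the order of their ranks. -/
noncomputable def rank (g : G) : ℕ :=
  {h | Relation.TransGen (fun a b => C.wire a b = true) h g}.ncard

theorem rank_lt_rank {h g : G} (hw : C.wire h g = true) : C.rank h < C.rank g := by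
  refine Set.ncard_lt_ncard (Set.ssubset_iff_of_subset ?_ |>.2 ⟨h, .single hw, C.acyclic h⟩)
  exact fun _ hk => Relation.TransGen.tail hk hw

theorem rank_lt_card (g : G) : C.rank g < Nat.card G := by
  rw [← Set.ncard_univ]
  exact Set.ncard_lt_ncard (Set.ssubset_univ_iff.2 fun h => C.acyclic g (h.ge (Set.mem_univ g)))

end Rank

end BooleanCircuit

/-! ## SHAP-scores from weighted counts -/

section ShapScore

variable {X : Type*}

/-- The probabilities of the two values of the feature `y` under the marginals `q`. -/
def bernoulliWeight (q : X → ℚ) (y : X) (b : Bool) : ℚ := if b = true then q y else 1 - q y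

/-- Integral weights, proportional to the marginals, of the two values of the feature `y`. -/
def marginalWeight (p : X → ℚ) (y : X) (b : Bool) : ℕ :=
  if b = true then (p y).num.natAbs else (p y).den - (p y).num.natAbs

/-- The weight `(p y).den` for the value of `e`, and `0` for the other one. -/
def entityWeight (p : X → ℚ) (e : X → Bool) (y : X) (b : Bool) : ℕ :=
  if e y = b then (p y).den else 0

/-- The sum of both weights of the feature `y`, with a factor `z y` that marks that `y` is fixed
to its value in `e`. -/
def mixedWeight (p : X → ℚ) (e : X → Bool) (z : X → ℕ) (y : X) (b : Bool) : ℕ :=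
  entityWeight p e y b * z y + marginalWeight p y b

/-- The integral weights of the product distribution in which the features in `S` are fixed to
their values in `e`. -/
def fixedWeight [DecidableEq X] (p : X → ℚ) (e : X → Bool) (S : Finset X) (y : X) (b : Bool) : ℕ :=
  if y ∈ S then entityWeight p e y b else marginalWeight p y b

theorem num_natAbs_le_den {q : ℚ} (h0 : 0 ≤ q) (h1 : q ≤ 1) : q.num.natAbs ≤ q.den := by
  have hnum : 0 ≤ q.num := Rat.num_nonneg.2 h0
  have hle : q.num ≤ q.den := by simpa using Rat.num_le_denom_iff.2 h1
  omega

theorem entityWeight_true_add_false (p : X → ℚ) (e : X → Bool) (y : X) :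
    entityWeight p e y true + entityWeight p e y false = (p y).den := by
  cases he : e y <;> simp [entityWeight, he]

theorem marginalWeight_true_add_false {p : X → ℚ} {y : X} (hp : 0 ≤ p y ∧ p y ≤ 1) :
    marginalWeight p y true + marginalWeight p y false = (p y).den := by
  simpa [marginalWeight] using Nat.add_sub_cancel' (num_natAbs_le_den hp.1 hp.2)

theorem natCast_marginalWeight {p : X → ℚ} {y : X} (hp : 0 ≤ p y ∧ p y ≤ 1) (b : Bool) :
    (marginalWeight p y b : ℚ) = (p y).den * bernoulliWeight p y b := by
  have habs : (((p y).num.natAbs : ℕ) : ℚ) = (p y).num := by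
    rw [← Int.cast_natCast, Int.natAbs_of_nonneg (Rat.num_nonneg.2 hp.1)]
  have hnum : ((p y).den : ℚ) * p y = (p y).num := by rw [mul_comm, Rat.mul_den_eq_num]
  cases b
  · simp [marginalWeight, bernoulliWeight, Nat.cast_sub (num_natAbs_le_den hp.1 hp.2), mul_sub,
      hnum, habs]
  · simp [marginalWeight, bernoulliWeight, hnum, habs]

theorem natCast_fixedWeight [DecidableEq X] {p : X → ℚ} {y : X} (hp : 0 ≤ p y ∧ p y ≤ 1)
    (e : X → Bool) (S : Finset X) (b : Bool) :
    (fixedWeight p e S y b : ℚ) = (p y).den * bernoulliWeight (fixMarginals p e S) y b := by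
  by_cases hy : y ∈ S
  · cases b <;> cases he : e y <;>
      simp [fixedWeight, entityWeight, bernoulliWeight, fixMarginals, hy, he]
  · simp [fixedWeight, bernoulliWeight, fixMarginals, hy, natCast_marginalWeight hp]

variable [Fintype X]

theorem productDistribution_eq_prod_bernoulliWeight (q : X → ℚ) (u : X → Bool) :
    productDistribution q u = ∏ y, bernoulliWeight q y (u y) := by
  simp [productDistribution, bernoulliWeight, Finset.prod_ite]

theorem totalWeight_bernoulliWeight (q : X → ℚ) : totalWeight (bernoulliWeight q) = 1 := by
  simp [totalWeight, bernoulliWeight]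

/-- The common denominator of the marginals. -/
def commonDen (p : X → ℚ) : ℕ := ∏ y, (p y).den

theorem commonDen_pos (p : X → ℚ) : 0 < commonDen p := Finset.prod_pos fun y _ => (p y).den_pos

variable [DecidableEq X]

theorem sum_consistentWith (p : X → ℚ) (e : X → Bool) (S : Finset X) (M : (X → Bool) → Bool) :
    ∑ u ∈ consistentWith e S, productDistribution p u * (if M u = true then 1 else 0) =
      (∏ y ∈ S, bernoulliWeight p y (e y)) *
        weightedCount (bernoulliWeight (fixMarginals p e S)) M := by
  have hweight : ∀ y b, (if y ∈ S then bernoulliWeight p y (e y) else 1) *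
      bernoulliWeight (fixMarginals p e S) y b =
        if y ∈ S ∧ b ≠ e y then 0 else bernoulliWeight p y b := fun y b => by
    by_cases hy : y ∈ S <;> cases b <;> cases he : e y <;>
      simp [bernoulliWeight, fixMarginals, hy, he]
  have hprod : ∀ u : X → Bool, (∏ y, if y ∈ S ∧ u y ≠ e y then 0 else bernoulliWeight p y (u y)) =
      if u ∈ consistentWith e S then productDistribution p u else 0 := fun u => by
    split_ifs with hu
    · have hu' : ∀ y ∈ S, u y = e y := by simpa [consistentWith] using hu
      rw [productDistribution_eq_prod_bernoulliWeight]
      exact Finset.prod_congr rfl fun y _ => if_neg fun h => h.2 (hu' y h.1)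
    · obtain ⟨y, hy, hne⟩ : ∃ y ∈ S, u y ≠ e y := by simpa [consistentWith] using hu
      exact Finset.prod_eq_zero (Finset.mem_univ y) (if_pos ⟨hy, hne⟩)
  rw [← Fintype.prod_ite_mem, ← weightedCount_mul_left]
  simp only [weightedCount, hweight, hprod, Finset.sum_ite_mem, mul_ite, mul_one, mul_zero,
    ← Finset.sum_filter]
  rw [Finset.filter_inter, Finset.univ_inter]

theorem condExpectation_eq_weightedCount (p : X → ℚ) (M : (X → Bool) → Bool) (e : X → Bool)
    (S : Finset X) :
    condExpectation p M e S = weightedCount (bernoulliWeight (fixMarginals p e S)) M := by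
  have hprob : ∑ u ∈ consistentWith e S, productDistribution p u =
      ∏ y ∈ S, bernoulliWeight p y (e y) := by
    simpa [weightedCount_true, totalWeight_bernoulliWeight] using
      sum_consistentWith p e S fun _ => true
  rw [condExpectation, sum_consistentWith, hprob]
  split_ifs with h
  · exact mul_div_cancel_left₀ _ h
  · simp [weightedCount, Finset.sum_filter, productDistribution_eq_prod_bernoulliWeight]

variable {p : X → ℚ} (hp : ∀ y, 0 ≤ p y ∧ p y ≤ 1) (e : X → Bool) (x : X) (M : (X → Bool) → Bool)

include hp in
theorem condExpectation_eq_div (S : Finset X) :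
    condExpectation p M e S = weightedCount (fixedWeight p e S) M / commonDen p := by
  rw [condExpectation_eq_weightedCount, eq_div_iff (by exact_mod_cast (commonDen_pos p).ne'),
    natCast_weightedCount, mul_comm, commonDen, Nat.cast_prod, ← weightedCount_mul_left]
  congr! 3 with y b
  exact (natCast_fixedWeight (hp y) e S b).symm

include hp in
theorem totalWeight_fixedWeight (S : Finset X) :
    totalWeight (fixedWeight p e S) = commonDen p :=
  Finset.prod_congr rfl fun y _ => by
    by_cases hy : y ∈ S
    · simp [fixedWeight, hy, entityWeight_true_add_false]
    · simp [fixedWeight, hy, marginalWeight_true_add_false (hp y)]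

/-- The sum of the weighted counts with the features in `insert x S`, if `b = true`, or in `S`, if
`b = false`, fixed to `e`, over the sets `S` of size `k` that do not contain `x`. -/
def fixedCount (p : X → ℚ) (e : X → Bool) (x : X) (M : (X → Bool) → Bool) (b : Bool) (k : ℕ) : ℕ :=
  ∑ S ∈ (Finset.univ.erase x).powersetCard k,
    weightedCount (fixedWeight p e (if b = true then insert x S else S)) M

include hp in
theorem fixedCount_lt (b : Bool) (k : ℕ) :
    fixedCount p e x M b k < 2 ^ Fintype.card X * commonDen p := by
  have hpow : 2 ^ (Finset.univ.erase x).card < 2 ^ Fintype.card X :=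
    Nat.pow_lt_pow_right one_lt_two (Finset.card_erase_lt_of_mem (Finset.mem_univ x))
  calc fixedCount p e x M b k
      ≤ ∑ _S ∈ (Finset.univ.erase x).powersetCard k, commonDen p :=
        Finset.sum_le_sum fun S _ => (weightedCount_le_totalWeight _ M).trans_eq
          (totalWeight_fixedWeight hp e _)
    _ = (Finset.univ.erase x).card.choose k * commonDen p := by simp
    _ ≤ 2 ^ (Finset.univ.erase x).card * commonDen p :=
        Nat.mul_le_mul_right _ (Nat.choose_le_two_pow _ _)
    _ < 2 ^ Fintype.card X * commonDen p := Nat.mul_lt_mul_of_pos_right hpow (commonDen_pos p)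

theorem sum_powerset_erase {R : Type*} [AddCommMonoid R] (f : Finset X → R) :
    ∑ S ∈ (Finset.univ.erase x).powerset, f S =
      ∑ k ∈ Finset.range (Fintype.card X), ∑ S ∈ (Finset.univ.erase x).powersetCard k, f S := by
  rw [Finset.sum_powerset, Finset.card_erase_add_one (Finset.mem_univ x), Finset.card_univ]

theorem weightedCount_mixedWeight (p : X → ℚ) (Z Y : ℕ) :
    weightedCount (mixedWeight p e fun y => if y = x then Y else Z) M =
      ∑ k ∈ Finset.range (Fintype.card X), fixedCount p e x M false k * Z ^ k +
        Y * ∑ k ∈ Finset.range (Fintype.card X), fixedCount p e x M true k * Z ^ k := by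
  have hprod : ∀ k, ∀ S ∈ (Finset.univ.erase x).powersetCard k,
      x ∉ S ∧ ∏ y ∈ S, (if y = x then Y else Z) = Z ^ k := fun k S hS => by
    obtain ⟨hsub, rfl⟩ := Finset.mem_powersetCard.1 hS
    exact ⟨fun h => Finset.notMem_erase x _ (hsub h), Finset.prod_eq_pow_card fun y hy =>
      if_neg (Finset.ne_of_mem_erase (hsub hy))⟩
  have hexpand := weightedCount_mul_add (entityWeight p e) (marginalWeight p)
    (fun y => if y = x then Y else Z) M
  refine hexpand.trans ?_
  rw [← Finset.powerset_univ, ← Finset.insert_erase (Finset.mem_univ x),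
    Finset.sum_powerset_insert (Finset.notMem_erase x _), sum_powerset_erase, sum_powerset_erase,
    Finset.mul_sum]
  simp only [fixedCount, Finset.sum_mul, Finset.mul_sum]
  congr 1 <;> refine Finset.sum_congr rfl fun k _ => Finset.sum_congr rfl fun S hS => ?_
  · rw [(hprod k S hS).2, mul_comm]
    rfl
  · rw [Finset.prod_insert (hprod k S hS).1, (hprod k S hS).2, if_pos rfl, if_pos trivial,
      mul_assoc, mul_comm (Z ^ k)]
    rfl

include hp in
theorem shapScore_eq_div :
    shapScore p M e x =
      (((∑ k ∈ Finset.range (Fintype.card X),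
            k.factorial * (Fintype.card X - 1 - k).factorial * fixedCount p e x M true k : ℕ) : ℚ) -
        ((∑ k ∈ Finset.range (Fintype.card X),
            k.factorial * (Fintype.card X - 1 - k).factorial * fixedCount p e x M false k : ℕ) :
              ℚ)) /
        ((commonDen p * (Fintype.card X).factorial : ℕ) : ℚ) := by
  have hden : ((commonDen p * (Fintype.card X).factorial : ℕ) : ℚ) ≠ 0 := by
    exact_mod_cast (Nat.mul_pos (commonDen_pos p) (Nat.factorial_pos _)).ne'
  rw [shapScore, sum_powerset_erase, eq_div_iff hden]
  push_cast at hden ⊢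
  rw [← Finset.sum_sub_distrib, Finset.sum_mul]
  refine Finset.sum_congr rfl fun k _ => ?_
  rw [fixedCount, fixedCount, ← mul_sub, Nat.cast_sum, Nat.cast_sum, ← Finset.sum_sub_distrib,
    Finset.sum_mul, Finset.mul_sum]
  refine Finset.sum_congr rfl fun S hS => ?_
  rw [condExpectation_eq_div hp, condExpectation_eq_div hp, (Finset.mem_powersetCard.1 hS).2,
    Nat.sub_right_comm]
  obtain ⟨hD, hF⟩ := mul_ne_zero_iff.1 hden
  simp only [if_true, Bool.false_eq_true, if_false]
  field_simp

end ShapScore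

section Digits

variable {b : ℕ} {c : ℕ → ℕ}

theorem sum_mul_pow_lt (hc : ∀ k, c k < b) (n : ℕ) : ∑ k ∈ Finset.range n, c k * b ^ k < b ^ n := by
  induction n with
  | zero => simp
  | succ n ih =>
    rw [Finset.sum_range_succ, pow_succ]
    nlinarith [Nat.mul_le_mul_right (b ^ n) (Nat.succ_le_of_lt (hc n))]

theorem sum_mul_pow_div_mod (hc : ∀ k, c k < b) {n i : ℕ} (hi : i < n) :
    (∑ k ∈ Finset.range n, c k * b ^ k) / b ^ i % b = c i := by
  obtain ⟨d, rfl⟩ := Nat.exists_eq_add_of_lt hi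
  have hsplit : ∑ k ∈ Finset.range (i + (d + 1)), c k * b ^ k =
      ∑ k ∈ Finset.range i, c k * b ^ k +
        b ^ i * (c i + b * ∑ k ∈ Finset.range d, c (i + (k + 1)) * b ^ k) := by
    rw [Finset.sum_range_add, Finset.sum_range_succ', mul_add, Finset.mul_sum, Finset.mul_sum]
    simp only [add_zero, add_comm _ (c i * b ^ i), mul_comm (b ^ i) (c i)]
    congr 2
    exact Finset.sum_congr rfl fun k _ => by ring
  rw [add_assoc, hsplit, Nat.add_mul_div_left _ _ (pow_pos ((Nat.zero_le _).trans_lt (hc 0)) i),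
    Nat.div_eq_of_lt (sum_mul_pow_lt hc i), zero_add, Nat.add_mul_mod_self_left,
    Nat.mod_eq_of_lt (hc i)]

end Digits

/-! ## Reasoning about random-access machine programs -/

theorem size_add_le (a b : ℕ) : Nat.size (a + b) ≤ Nat.size a + Nat.size b + 1 := by
  have ha : 2 ^ Nat.size a ≤ 2 ^ (Nat.size a + Nat.size b) :=
    Nat.pow_le_pow_right two_pos (Nat.le_add_right _ _)
  have hb : 2 ^ Nat.size b ≤ 2 ^ (Nat.size a + Nat.size b) :=
    Nat.pow_le_pow_right two_pos (Nat.le_add_left _ _)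
  rw [Nat.size_le, pow_succ]
  linarith [Nat.lt_size_self a, Nat.lt_size_self b]

theorem size_mul_le (a b : ℕ) : Nat.size (a * b) ≤ Nat.size a + Nat.size b := by
  rw [Nat.size_le, pow_add]
  exact Nat.mul_lt_mul'' (Nat.lt_size_self a) (Nat.lt_size_self b)

/-- All cells of the memory hold numbers with at most `L` binary digits. -/
def RamMemory.Bounded (L : ℕ) (σ : RamMemory) : Prop := ∀ k i, σ k i < 2 ^ L

namespace RamExpr

/-- A coefficient that bounds size and cost of an expression linearly in the number of digits of
the memory cells. -/
def weight : RamExpr → ℕ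
  | lit c => Nat.size c + 1
  | read _ i => 2 * i.weight + 2
  | add a b => 2 * (a.weight + b.weight) + 1
  | sub a b => 2 * (a.weight + b.weight) + 1
  | mul a b => 2 * (a.weight + b.weight) + 1
  | div a b => 2 * (a.weight + b.weight) + 1

theorem size_value_le_and_cost_le {L : ℕ} {σ : RamMemory} (hσ : σ.Bounded L) (a : RamExpr) :
    Nat.size (a.value σ) ≤ a.weight * (L + 1) ∧ a.cost σ ≤ a.weight * (L + 1) := by
  induction a with
  | lit c => constructor <;> simp only [value, cost, weight] <;> nlinarith
  | read k i ih =>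
    have h := Nat.size_le.2 (hσ k (i.value σ))
    constructor <;> simp only [value, cost, weight] <;> nlinarith
  | add a b iha ihb =>
    have h := size_add_le (a.value σ) (b.value σ)
    constructor <;> simp only [value, cost, weight] <;> nlinarith
  | sub a b iha ihb =>
    have h : Nat.size (a.value σ - b.value σ) ≤ _ := Nat.size_le_size (Nat.sub_le _ _)
    constructor <;> simp only [value, cost, weight] <;> nlinarith
  | mul a b iha ihb =>
    have h := size_mul_le (a.value σ) (b.value σ)
    constructor <;> simp only [value, cost, weight] <;> nlinarith
  | div a b iha ihb =>
    have h : Nat.size (a.value σ / b.value σ) ≤ _ := Nat.size_le_size (Nat.div_le_self _ _)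
    constructor <;> simp only [value, cost, weight] <;> nlinarith

end RamExpr

namespace RamProg

/-- The arrays that a program may write to. -/
def writes : RamProg → List ℕ
  | skip => []
  | write k _ _ => [k]
  | seq c d => c.writes ++ d.writes
  | branch _ c d => c.writes ++ d.writes
  | loop _ c => c.writes

open Polynomial in
/-- If every loop makes at most `L` iterations and all numbers stay below `2 ^ L`, the running
time is at most `L + 1` times the value of this polynomial at `L`. -/
noncomputable def timeBound : RamProg → ℕ[X]
  | skip => 1
  | write _ i a => C (2 * (i.weight + a.weight) + 1)
  | seq c d => c.timeBound + d.timeBound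
  | branch a c d => C (a.weight + 1) + c.timeBound + d.timeBound
  | loop a c => (X + 1) * (C (a.weight + 1) + c.timeBound)

end RamProg

theorem RamExec.eq_of_notMem_writes {c : RamProg} {σ τ : RamMemory} {t : ℕ}
    (h : RamExec c σ τ t) {k : ℕ} (hk : k ∉ c.writes) : τ k = σ k := by
  induction h with
  | skip => rfl
  | write => exact Function.update_of_ne (List.ne_of_not_mem_cons hk) _ _
  | seq _ _ ihc ihd =>
    rw [ihd fun hd => hk (List.mem_append_right _ hd),
      ihc fun hc => hk (List.mem_append_left _ hc)]
  | branch_true _ _ ih => exact ih fun hc => hk (List.mem_append_left _ hc)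
  | branch_false _ _ ih => exact ih fun hd => hk (List.mem_append_right _ hd)
  | loop_done => rfl
  | loop_step _ _ _ ihc ihloop => rw [ihloop hk, ihc hk]

/-- Started in `σ` with all numbers below `2 ^ L`, the program `c` halts within the time given by
its `timeBound`, with all numbers below `2 ^ L`, in a memory that satisfies `Q`. -/
def Runs (L : ℕ) (c : RamProg) (σ : RamMemory) (Q : RamMemory → Prop) : Prop :=
  σ.Bounded L → ∃ τ t, RamExec c σ τ t ∧ t ≤ c.timeBound.eval L * (L + 1) ∧ τ.Bounded L ∧ Q τ

namespace Runs

variable {L : ℕ} {σ : RamMemory} {Q R : RamMemory → Prop} {c d : RamProg}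

theorem mono (h : Runs L c σ Q) (hQ : ∀ τ, (∀ k ∉ c.writes, τ k = σ k) → Q τ → R τ) :
    Runs L c σ R := fun hσ =>
  let ⟨τ, t, hexec, ht, hτ, hpost⟩ := h hσ
  ⟨τ, t, hexec, ht, hτ, hQ τ (fun _ hk => hexec.eq_of_notMem_writes hk) hpost⟩

theorem skip (h : Q σ) : Runs L .skip σ Q := fun hσ =>
  ⟨σ, 1, .skip σ, by simp [RamProg.timeBound], hσ, h⟩

theorem write {k : ℕ} {i a : RamExpr} (ha : a.value σ < 2 ^ L)
    (h : Q (Function.update σ k (Function.update (σ k) (i.value σ) (a.value σ)))) :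
    Runs L (.write k i a) σ Q := fun hσ => by
  refine ⟨_, _, .write k i a σ, ?_, fun k' j => ?_, h⟩
  · have hi := i.size_value_le_and_cost_le hσ
    have ha := a.size_value_le_and_cost_le hσ
    simp only [RamProg.timeBound, Polynomial.eval_C]
    nlinarith
  · obtain rfl | hk := eq_or_ne k' k
    · obtain rfl | hj := eq_or_ne j (i.value σ)
      · simpa using ha
      · simpa [hj] using hσ _ j
    · simpa [hk] using hσ k' j

theorem seq (hc : Runs L c σ Q)
    (hd : ∀ τ, (∀ k ∉ c.writes, τ k = σ k) → Q τ → Runs L d τ R) : Runs L (.seq c d) σ R :=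
  fun hσ => by
  obtain ⟨τ, s, hexec, hs, hτ, hQ⟩ := hc hσ
  obtain ⟨υ, t, hexec', ht, hυ, hR⟩ := hd τ (fun _ hk => hexec.eq_of_notMem_writes hk) hQ hτ
  refine ⟨υ, _, .seq hexec hexec', ?_, hυ, hR⟩
  rw [RamProg.timeBound, Polynomial.eval_add, add_mul]
  exact add_le_add hs ht

theorem branch {a : RamExpr} (hc : a.value σ ≠ 0 → Runs L c σ Q)
    (hd : a.value σ = 0 → Runs L d σ Q) : Runs L (.branch a c d) σ Q := fun hσ => by
  have ha := a.size_value_le_and_cost_le hσ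
  by_cases h : a.value σ = 0
  · obtain ⟨τ, t, hexec, ht, hτ, hQ⟩ := hd h hσ
    refine ⟨τ, _, .branch_false h hexec, ?_, hτ, hQ⟩
    simp only [RamProg.timeBound, Polynomial.eval_add, Polynomial.eval_C]
    nlinarith
  · obtain ⟨τ, t, hexec, ht, hτ, hQ⟩ := hc h hσ
    refine ⟨τ, _, .branch_true h hexec, ?_, hτ, hQ⟩
    simp only [RamProg.timeBound, Polynomial.eval_add, Polynomial.eval_C]
    nlinarith

/-- `I j` is the invariant when at most `j` iterations remain. -/
theorem loop {a : RamExpr} (I : ℕ → RamMemory → Prop) {N : ℕ} (hN : N ≤ L) (hI : I N σ)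
    (hexit : ∀ τ, I 0 τ → a.value τ = 0)
    (hstep : ∀ j τ, I (j + 1) τ → a.value τ ≠ 0 → Runs L c τ (I j)) :
    Runs L (.loop a c) σ fun τ => a.value τ = 0 ∧ ∃ j, I j τ := fun hσ => by
  suffices ∃ τ t, RamExec (.loop a c) σ τ t ∧
      t ≤ (N + 1) * ((a.weight + 1 + c.timeBound.eval L) * (L + 1)) ∧
      τ.Bounded L ∧ a.value τ = 0 ∧ ∃ j, I j τ by
    obtain ⟨τ, t, hexec, ht, h⟩ := this
    refine ⟨τ, t, hexec, ht.trans ?_, h⟩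
    simp only [RamProg.timeBound, Polynomial.eval_mul, Polynomial.eval_add, Polynomial.eval_C,
      Polynomial.eval_X, Polynomial.eval_one, mul_assoc]
    gcongr
  clear hN
  induction N generalizing σ with
  | zero =>
    have ha := a.size_value_le_and_cost_le hσ
    exact ⟨σ, _, .loop_done (hexit σ hI), by nlinarith, hσ, hexit σ hI, 0, hI⟩
  | succ N ih =>
    have ha := a.size_value_le_and_cost_le hσ
    by_cases h : a.value σ = 0
    · refine ⟨σ, _, .loop_done h, ?_, hσ, h, _, hI⟩
      nlinarith [Nat.zero_le ((N + 1) * ((a.weight + 1 + c.timeBound.eval L) * (L + 1)))]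
    · obtain ⟨τ, s, hexec, hs, hτ, hI'⟩ := hstep N σ hI h hσ
      obtain ⟨υ, t, hexec', ht, hpost⟩ := ih hI' hτ
      exact ⟨υ, _, .loop_step h hexec hexec', by nlinarith, hpost⟩

end Runs

namespace RamExpr

/-- The content of cell `0` of array `k`, which serves as a register. -/
def reg (k : ℕ) : RamExpr := read k (lit 0)

variable (σ : RamMemory) (a b : RamExpr)

@[simp] theorem value_lit (c : ℕ) : (lit c).value σ = c := rfl
@[simp] theorem value_reg (k : ℕ) : (reg k).value σ = σ k 0 := rfl
@[simp] theorem value_read (k : ℕ) : (read k a).value σ = σ k (a.value σ) := rfl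
@[simp] theorem value_add : (add a b).value σ = a.value σ + b.value σ := rfl
@[simp] theorem value_sub : (sub a b).value σ = a.value σ - b.value σ := rfl
@[simp] theorem value_mul : (mul a b).value σ = a.value σ * b.value σ := rfl
@[simp] theorem value_div : (div a b).value σ = a.value σ / b.value σ := rfl

/-- Remainder of the integer division of `a` by `b`. -/
def mod : RamExpr := sub a (mul b (div a b))

@[simp] theorem value_mod : (mod a b).value σ = a.value σ % b.value σ :=
  (Nat.mod_eq_sub_mul_div).symm

end RamExpr

namespace RamProg

open RamExpr

/-- Store the value of `a` in register `k`. -/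
def assign (k : ℕ) (a : RamExpr) : RamProg := write k (lit 0) a

/-- Run `d` for the values `0, …, N - 1` of register `c`. -/
def forLoop (c : ℕ) (N : RamExpr) (d : RamProg) : RamProg :=
  seq (assign c (lit 0)) (loop (sub N (reg c)) (seq d (assign c (add (reg c) (lit 1)))))

/-- Start with the value of `init` in register `k`, and replace it by the value of `step` for each
of the values `0, …, N - 1` of register `c`. -/
def foldLoop (c : ℕ) (N : RamExpr) (k : ℕ) (init step : RamExpr) : RamProg :=
  seq (assign k init) (forLoop c N (assign k step))

/-- Store the value of `init` in cell `0` of array `k`, and the value of `step` in cell `i + 1` for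
each of the values `i = 0, …, N - 1` of register `c`. -/
def table (c : ℕ) (N : RamExpr) (k : ℕ) (init step : RamExpr) : RamProg :=
  seq (write k (lit 0) init) (forLoop c N (write k (add (reg c) (lit 1)) step))

/-- Compute in register `k` the product of the values of `a` for the values `0, …, N - 1` of
register `c`. -/
def prodLoop (c : ℕ) (N : RamExpr) (k : ℕ) (a : RamExpr) : RamProg :=
  foldLoop c N k (lit 1) (mul (reg k) a)

/-- Compute in register `k` the sum of the values of `a` for the values `0, …, N - 1` of
register `c`. -/
def sumLoop (c : ℕ) (N : RamExpr) (k : ℕ) (a : RamExpr) : RamProg :=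
  foldLoop c N k (lit 0) (add (reg k) a)

/-- Run the program in the list whose position, counted from `0`, is the value of `a`. -/
def switch (a : RamExpr) : List RamProg → RamProg
  | [] => skip
  | c :: cs => branch a (switch (sub a (lit 1)) cs) c

/-- Euclid's algorithm: replace the content of register `u` by its greatest common divisor with
the content of register `v`. -/
def euclid (u v r : ℕ) : RamProg :=
  loop (reg v) (seq (assign r (mod (reg u) (reg v))) (seq (assign u (reg v)) (assign v (reg r))))

@[simp] theorem writes_assign (k : ℕ) (a : RamExpr) : (assign k a).writes = [k] := rfl

end RamProg

theorem filter_val_lt_succ {n i : ℕ} (hi : i < n) :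
    ({j | j.val < i + 1} : Finset (Fin n)) = insert ⟨i, hi⟩ ({j | j.val < i} : Finset (Fin n)) := by
  ext j
  simp [Fin.ext_iff, le_iff_eq_or_lt]

namespace Runs

variable {L : ℕ} {σ : RamMemory} {Q : RamMemory → Prop} {d : RamProg} {c k n : ℕ}
  {N a : RamExpr}

theorem write_array {i : RamExpr} (ha : a.value σ < 2 ^ L) :
    Runs L (.write k i a) σ fun τ => τ k = Function.update (σ k) (i.value σ) (a.value σ) :=
  write ha (by simp)

theorem assign (ha : a.value σ < 2 ^ L) :
    Runs L (.assign k a) σ fun τ => τ k 0 = a.value σ :=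
  write ha (by simp)

/-- `P i` is the invariant, on the array `k`, before the iteration with value `i` of the
counter. -/
theorem forLoop (P : ℕ → (ℕ → ℕ) → Prop) (hn : n ≤ L) (hck : c ≠ k) (hc : c ∉ d.writes)
    (hN : ∀ τ : RamMemory, (∀ j ∉ c :: d.writes, τ j = σ j) → N.value τ = n) (h0 : P 0 (σ k))
    (hstep : ∀ i < n, ∀ τ : RamMemory, (∀ j ∉ c :: d.writes, τ j = σ j) → τ c 0 = i →
      P i (τ k) → Runs L d τ fun υ => P (i + 1) (υ k)) :
    Runs L (.forLoop c N d) σ fun τ => P n (τ k) := by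
  have hL : L < 2 ^ L := Nat.lt_two_pow_self
  let I : ℕ → RamMemory → Prop := fun r τ => (∀ j ∉ c :: d.writes, τ j = σ j) ∧
    ∃ i, i + r = n ∧ τ c 0 = i ∧ P i (τ k)
  refine seq (assign (by simp)) fun σ' hσ' hc0 => ?_
  have hI : I n σ' := by
    refine ⟨fun j hj => hσ' j fun h => hj ?_, 0, zero_add n, hc0, ?_⟩
    · simp_all
    · rwa [hσ' k (by simpa using hck.symm)]
  refine (loop I hn hI ?_ ?_).mono ?_
  · rintro τ ⟨hτ, i, rfl, hi, -⟩
    simp [hN τ hτ, hi]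
  · rintro r τ ⟨hτ, i, hir, hi, hP⟩ -
    refine seq (hstep i (by omega) τ hτ hi hP) fun υ hυ hP' => ?_
    have hi' : υ c 0 = i := by rw [hυ c hc, hi]
    refine (assign (by simp [hi']; omega)).mono fun ξ hξ hi'' => ?_
    have hξ' : ∀ j ≠ c, ξ j = υ j := fun j hj =>
      hξ j (by simpa using hj)
    refine ⟨fun j hj => ?_, i + 1, by omega, by simpa [hi'] using hi'', by rwa [hξ' k hck.symm]⟩
    rw [hξ' j (List.ne_of_not_mem_cons hj), hυ j (List.not_mem_of_not_mem_cons hj), hτ j hj]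
  · rintro τ - ⟨hdone, r, hτ, i, hir, hi, hP⟩
    rw [RamExpr.value_sub, hN τ hτ, RamExpr.value_reg, hi] at hdone
    obtain rfl : i = n := by omega
    exact hP

theorem foldLoop {init step : RamExpr} (v : ℕ → ℕ) (hn : n ≤ L) (hck : c ≠ k)
    (hN : ∀ τ : RamMemory, (∀ j ∉ [c, k], τ j = σ j) → N.value τ = n)
    (hinit : init.value σ = v 0) (hlt : ∀ i ≤ n, v i < 2 ^ L)
    (hstep : ∀ i < n, ∀ τ : RamMemory, (∀ j ∉ [c, k], τ j = σ j) → τ c 0 = i → τ k 0 = v i →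
      step.value τ = v (i + 1)) :
    Runs L (.foldLoop c N k init step) σ fun τ => τ k 0 = v n := by
  refine seq (assign (hinit ▸ hlt 0 n.zero_le)) fun σ' hσ' hk => ?_
  have hoff : ∀ τ : RamMemory, (∀ j ∉ [c, k], τ j = σ' j) → ∀ j ∉ [c, k], τ j = σ j :=
    fun τ hτ j hj => (hτ j hj).trans (hσ' j (List.not_mem_of_not_mem_cons hj))
  refine forLoop (fun i b => b 0 = v i) hn hck (by simpa)
    (fun τ hτ => hN τ (hoff τ hτ)) (hk.trans hinit) fun i hi τ hτ hc hki => ?_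
  have hval := hstep i hi τ (hoff τ hτ) hc hki
  exact (assign (hval ▸ hlt _ hi)).mono fun _ _ h => h.trans hval

theorem table {init step : RamExpr} (v : ℕ → ℕ) (hn : n ≤ L) (hck : c ≠ k)
    (hN : ∀ τ : RamMemory, (∀ j ∉ [c, k], τ j = σ j) → N.value τ = n)
    (hinit : init.value σ = v 0) (hlt : ∀ i ≤ n, v i < 2 ^ L)
    (hstep : ∀ i < n, ∀ τ : RamMemory, (∀ j ∉ [c, k], τ j = σ j) → τ c 0 = i → τ k i = v i →
      step.value τ = v (i + 1)) :
    Runs L (.table c N k init step) σ fun τ => ∀ i ≤ n, τ k i = v i := by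
  refine seq (write_array (hinit ▸ hlt 0 n.zero_le)) fun σ' hσ' hk => ?_
  have hoff : ∀ τ : RamMemory, (∀ j ∉ [c, k], τ j = σ' j) → ∀ j ∉ [c, k], τ j = σ j :=
    fun τ hτ j hj => (hτ j hj).trans (hσ' j (List.not_mem_of_not_mem_cons hj))
  refine forLoop (fun i b => ∀ j ≤ i, b j = v j) hn hck (by simpa [RamProg.writes])
    (fun τ hτ => hN τ (hoff τ hτ)) (by simp [hk, hinit]) fun i hi τ hτ hc hki => ?_
  have hval := hstep i hi τ (hoff τ hτ) hc (hki i le_rfl)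
  refine (write_array (hval ▸ hlt _ hi)).mono fun υ _ hυ j hj => ?_
  rw [hυ, RamExpr.value_add, RamExpr.value_reg, hc, RamExpr.value_lit, hval]
  obtain rfl | hj' := Nat.of_le_succ hj |>.symm
  · exact Function.update_self ..
  · rw [Function.update_of_ne (by omega), hki j hj']

theorem prodLoop (f : Fin n → ℕ) (hn : n ≤ L) (hck : c ≠ k)
    (hN : ∀ τ : RamMemory, (∀ j ∉ [c, k], τ j = σ j) → N.value τ = n)
    (ha : ∀ i : Fin n, ∀ τ : RamMemory, (∀ j ∉ [c, k], τ j = σ j) → τ c 0 = i → a.value τ = f i)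
    (hlt : ∀ s : Finset (Fin n), ∏ i ∈ s, f i < 2 ^ L) :
    Runs L (.prodLoop c N k a) σ fun τ => τ k 0 = ∏ i, f i := by
  refine (foldLoop (fun i => ∏ j with j.val < i, f j) hn hck hN (by simp) (fun _ _ => hlt _)
    fun i hi τ hτ hc hk => ?_).mono fun τ _ hτ => by simpa using hτ
  rw [filter_val_lt_succ hi, Finset.prod_insert (by simp), mul_comm, RamExpr.value_mul,
    RamExpr.value_reg, hk, ha ⟨i, hi⟩ τ hτ hc]

theorem sumLoop (f : Fin n → ℕ) (hn : n ≤ L) (hck : c ≠ k)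
    (hN : ∀ τ : RamMemory, (∀ j ∉ [c, k], τ j = σ j) → N.value τ = n)
    (ha : ∀ i : Fin n, ∀ τ : RamMemory, (∀ j ∉ [c, k], τ j = σ j) → τ c 0 = i → a.value τ = f i)
    (hlt : ∑ i, f i < 2 ^ L) :
    Runs L (.sumLoop c N k a) σ fun τ => τ k 0 = ∑ i, f i := by
  refine (foldLoop (fun i => ∑ j with j.val < i, f j) hn hck hN (by simp)
    (fun _ _ => (Finset.sum_le_univ_sum_of_nonneg fun _ => Nat.zero_le _).trans_lt hlt)
    fun i hi τ hτ hc hk => ?_).mono fun τ _ hτ => by simpa using hτ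
  rw [filter_val_lt_succ hi, Finset.sum_insert (by simp), add_comm, RamExpr.value_add,
    RamExpr.value_reg, hk, ha ⟨i, hi⟩ τ hτ hc]

theorem switch {e : RamProg} {l : List RamProg} {i : ℕ} (hi : a.value σ = i)
    (hl : l[i]? = some e) (he : Runs L e σ Q) : Runs L (.switch a l) σ Q := by
  induction l generalizing a i with
  | nil => simp at hl
  | cons d l ih =>
    refine branch (fun h => ?_) fun h => ?_
    · obtain ⟨i, rfl⟩ := Nat.exists_eq_succ_of_ne_zero (hi ▸ h)
      exact ih (i := i) (by simp [hi]) (by simpa using hl)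
    · obtain rfl : d = e := by simpa [← hi, h] using hl
      exact he

theorem euclid {u v r : ℕ} (huv : u ≠ v) (hur : u ≠ r) (hvr : v ≠ r) (hle : σ v 0 ≤ σ u 0)
    (hlt : σ u 0 * σ v 0 < 2 ^ L) :
    Runs L (.euclid u v r) σ fun τ => τ u 0 = Nat.gcd (σ u 0) (σ v 0) := by
  refine (loop (fun s τ => τ v 0 ≤ τ u 0 ∧ τ u 0 * τ v 0 < 2 ^ s ∧ s ≤ L ∧
    Nat.gcd (τ u 0) (τ v 0) = Nat.gcd (σ u 0) (σ v 0)) le_rfl ⟨hle, hlt, le_rfl, rfl⟩ ?_ ?_).mono ?_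
  · rintro τ ⟨hle, hlt, -⟩
    have : τ v 0 * τ v 0 < 1 := (Nat.mul_le_mul_right _ hle).trans_lt hlt
    rw [RamExpr.value_reg]
    nlinarith
  · rintro s τ ⟨hle, hlt, hs, hgcd⟩ hv
    have hpos : 0 < τ v 0 := Nat.pos_of_ne_zero hv
    have hmod : τ u 0 % τ v 0 < τ v 0 := Nat.mod_lt _ hpos
    have hL : τ u 0 < 2 ^ L := (Nat.le_mul_of_pos_right _ hpos).trans_lt
      (hlt.trans_le (Nat.pow_le_pow_right two_pos hs))
    -- The remainder is at most half of `τ u 0`.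
    have hhalf : 2 * (τ v 0 * (τ u 0 % τ v 0)) ≤ τ u 0 * τ v 0 := by
      have hadd : τ v 0 + τ u 0 % τ v 0 ≤ τ u 0 := by
        rw [Nat.mod_eq_sub_mul_div]
        have := Nat.le_mul_of_pos_right (τ v 0) (Nat.div_pos hle hpos)
        have := Nat.mul_div_le (τ u 0) (τ v 0)
        omega
      nlinarith
    refine seq (assign (by rw [RamExpr.value_mod]; exact hmod.trans_le hle |>.trans hL))
      fun τ₁ h₁ hr => ?_
    have hv₁ : τ₁ v 0 = τ v 0 := by rw [h₁ v (by simpa)]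
    refine seq (assign (by rw [RamExpr.value_reg]; omega)) fun τ₂ h₂ hu => ?_
    have hr₂ : τ₂ r 0 = τ u 0 % τ v 0 := by rw [h₂ r (by simpa using hur.symm)]; simpa using hr
    refine (assign (by rw [RamExpr.value_reg]; omega)).mono fun τ₃ h₃ hv' => ?_
    replace hu : τ₃ u 0 = τ v 0 := by rw [h₃ u (by simpa)]; exact hu.trans hv₁
    replace hv' : τ₃ v 0 = τ u 0 % τ v 0 := hv'.trans hr₂
    rw [pow_succ] at hlt
    rw [hu, hv', ← hgcd]
    refine ⟨hmod.le, by omega, by omega, ?_⟩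
    rw [Nat.gcd_comm, ← Nat.gcd_rec, Nat.gcd_comm]
  · rintro τ - ⟨hv, s, -, -, -, hgcd⟩
    rwa [show τ v 0 = 0 from hv, Nat.gcd_zero_right] at hgcd

end Runs

/-! ## Layout of the input -/

theorem getD_flatMap_finRange_append {α : Type*} {n k : ℕ} (f : Fin n → List α)
    (hf : ∀ i, (f i).length = k) (i : Fin n) {j : ℕ} (hj : j < k) (d : α) (l : List α) :
    ((List.finRange n).flatMap f ++ l).getD (k * i + j) d = (f i).getD j d := by
  induction n with
  | zero => exact i.elim0
  | succ n ih =>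
    rw [List.finRange_succ, List.flatMap_cons, List.append_assoc, List.flatMap_map]
    cases i using Fin.cases with
    | zero =>
      simp only [Fin.val_zero, mul_zero, zero_add]
      rw [List.getD_append _ _ _ _ (by rwa [hf])]
    | succ i =>
      rw [List.getD_append_right _ _ _ _ (by rw [hf, Fin.val_succ, mul_add]; omega), hf,
        ← ih (fun i => f i.succ) (fun i => hf _) i]
      congr 1
      rw [Fin.val_succ, mul_add]
      omega

theorem getD_flatMap_finRange_append_right {α : Type*} {n k : ℕ} (f : Fin n → List α)
    (hf : ∀ i, (f i).length = k) (j : ℕ) (d : α) (l : List α) :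
    ((List.finRange n).flatMap f ++ l).getD (k * n + j) d = l.getD j d := by
  have hlength : ((List.finRange n).flatMap f).length = k * n := by
    simp [List.length_flatMap, hf, mul_comm]
  rw [List.getD_append_right _ _ _ _ (by omega), hlength]
  congr 1
  omega

theorem GateLabel.length_encode {n : ℕ} (l : GateLabel (Fin n)) : l.encode.length = 2 := by
  cases l <;> rfl

namespace ShapInput

variable (I : ShapInput)

/-- The content of array `0` at the start of the computation. -/
def tape : ℕ → ℕ := ramInput I.encode 0

theorem tape_add_three (j : ℕ) : I.tape (3 + j) =
    ((List.finRange I.m).flatMap (fun g => (I.C.label g).encode)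
    ++ ((List.finRange I.m).flatMap
        (fun g => (List.finRange I.m).map fun g' => (I.C.wire g g').toNat)
    ++ ((List.finRange I.n).flatMap (fun y => encodeRat (I.p y))
    ++ ((List.finRange I.n).flatMap (fun y => [(I.e y).toNat])
    ++ [(I.x : ℕ)])))).getD j 0 := by
  simp only [tape, ramInput, encode, if_true, List.append_assoc,
    List.map_eq_flatMap (f := fun y => (I.e y).toNat), add_comm 3 j]
  rfl

theorem tape_one : I.tape 1 = I.n := by simp [tape, ramInput, encode]

theorem tape_two : I.tape 2 = I.m := by simp [tape, ramInput, encode]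

theorem tape_label (g : Fin I.m) {j : ℕ} (hj : j < 2) :
    I.tape (3 + (2 * g + j)) = (I.C.label g).encode.getD j 0 := by
  rw [tape_add_three, getD_flatMap_finRange_append _ (fun _ => GateLabel.length_encode _) _ hj]

theorem tape_wire (g h : Fin I.m) :
    I.tape (3 + (2 * I.m + (I.m * g + h))) = (I.C.wire g h).toNat := by
  rw [tape_add_three, getD_flatMap_finRange_append_right _ (fun _ => GateLabel.length_encode _),
    getD_flatMap_finRange_append _ (k := I.m) (by simp) _ h.2]
  simp

theorem tape_marginals (j : ℕ) : I.tape (3 + (2 * I.m + (I.m * I.m + j))) =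
    ((List.finRange I.n).flatMap (fun y => encodeRat (I.p y))
      ++ ((List.finRange I.n).flatMap (fun y => [(I.e y).toNat]) ++ [(I.x : ℕ)])).getD j 0 := by
  rw [tape_add_three, getD_flatMap_finRange_append_right _ (fun _ => GateLabel.length_encode _),
    getD_flatMap_finRange_append_right _ (k := I.m) (by simp)]

theorem tape_marginal (y : Fin I.n) {j : ℕ} (hj : j < 3) :
    I.tape (3 + (2 * I.m + (I.m * I.m + (3 * y + j)))) = (encodeRat (I.p y)).getD j 0 := by
  rw [tape_marginals, getD_flatMap_finRange_append _ (k := 3) (by simp [encodeRat]) _ hj]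

theorem tape_entity (y : Fin I.n) :
    I.tape (3 + (2 * I.m + (I.m * I.m + (3 * I.n + y)))) = (I.e y).toNat := by
  rw [tape_marginals, getD_flatMap_finRange_append_right _ (k := 3) (by simp [encodeRat])]
  simpa using getD_flatMap_finRange_append (fun y => [(I.e y).toNat]) (fun _ => rfl) y zero_lt_one
    0 [(I.x : ℕ)]

theorem tape_feature : I.tape (3 + (2 * I.m + (I.m * I.m + (3 * I.n + I.n)))) = I.x := by
  rw [tape_marginals, getD_flatMap_finRange_append_right _ (k := 3) (by simp [encodeRat])]
  simp

end ShapInput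

/-! ## The score in terms of one weighted count -/

theorem encodeRat_sub_div (a b : ℕ) {d : ℕ} (hd : 0 < d) :
    encodeRat (((a : ℚ) - b) / d) =
      [if a < b then 1 else 0, ((a - b) + (b - a)) / Nat.gcd ((a - b) + (b - a)) d,
        d / Nat.gcd ((a - b) + (b - a)) d] := by
  have hnatAbs : ((a : ℤ) - b).natAbs = (a - b) + (b - a) := by omega
  have hnormalize : ((a : ℚ) - b) / d = Rat.normalize ((a : ℤ) - b) d hd.ne' := by
    rw [Rat.normalize_eq_mkRat, Rat.mkRat_eq_div]
    push_cast
    rfl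
  have hneg : ((a : ℚ) - b) / d < 0 ↔ a < b := by
    have hd' : (0 : ℚ) < d := by exact_mod_cast hd
    rw [div_lt_iff₀ hd', zero_mul, sub_neg, Nat.cast_lt]
  rw [encodeRat, if_congr hneg rfl rfl, hnormalize, Rat.normalize_eq]
  simp only [hnatAbs]
  rw [Int.natAbs_ediv_of_dvd, hnatAbs, Int.natAbs_natCast]
  exact Int.natCast_dvd.2 (by rw [hnatAbs]; exact Nat.gcd_dvd_left _ _)

namespace ShapInput

variable (I : ShapInput)

/-- A base in which the `fixedCount`s are digits. -/
def base : ℕ := 2 ^ I.n * commonDen I.p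

/-- The factors that mark the fixed features. The counts are below `base`, so the count of the
classifier under the `mixedWeight` with these factors has the counts `fixedCount … false k` as its
lower `n` digits, and the counts `fixedCount … true k` as its upper `n` digits. -/
def marker (y : Fin I.n) : ℕ := if y = I.x then I.base ^ I.n else I.base

/-- The weights with which the circuit is evaluated. -/
def weight : Fin I.n → Bool → ℕ := mixedWeight I.p I.e I.marker

/-- The weighted count of the classifier. -/
noncomputable def count : ℕ := weightedCount I.weight I.C.classifier

/-- The `k`-th digit of the upper half (for `b = true`) or lower half (for `b = false`) of the
weighted count of the classifier. -/
noncomputable def digit (b : Bool) (k : ℕ) : ℕ := fixedCount I.p I.e I.x I.C.classifier b k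

/-- The sum of the positive terms (for `b = true`) or of the absolute values of the negative terms
(for `b = false`) of the score, over the denominator `scoreDen`. -/
noncomputable def scorePart (b : Bool) : ℕ :=
  ∑ k : Fin I.n, k.val.factorial * (I.n - 1 - k).factorial * I.digit b k

/-- The weighted number of all entities. -/
def total : ℕ := totalWeight I.weight

/-- The denominator of the score before reduction. -/
def scoreDen : ℕ := commonDen I.p * I.n.factorial

/-- The absolute value of the numerator of the score before reduction, in a form without negative
numbers. -/
noncomputable def scoreNum : ℕ :=
  (I.scorePart true - I.scorePart false) + (I.scorePart false - I.scorePart true)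

theorem n_pos : 0 < I.n := (Nat.zero_le _).trans_lt I.x.2

theorem base_pos : 0 < I.base := Nat.mul_pos (by positivity) (commonDen_pos _)

theorem base_le_pow : I.base ≤ I.base ^ I.n := Nat.le_self_pow I.n_pos.ne' _

theorem prod_two_mul_den : ∏ y, 2 * (I.p y).den = I.base := by
  simp [base, commonDen, Finset.prod_mul_distrib]

theorem scoreDen_pos : 0 < I.scoreDen := Nat.mul_pos (commonDen_pos _) (Nat.factorial_pos _)

theorem count_eq : I.count =
    ∑ k ∈ Finset.range I.n, I.digit false k * I.base ^ k +
      I.base ^ I.n * ∑ k ∈ Finset.range I.n, I.digit true k * I.base ^ k := by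
  have h := weightedCount_mixedWeight I.e I.x I.C.classifier I.p I.base (I.base ^ I.n)
  rwa [Fintype.card_fin] at h

variable {I} (hp : ∀ y, 0 ≤ I.p y ∧ I.p y ≤ 1)

include hp

theorem weight_true_add_false (y : Fin I.n) :
    I.weight y true + I.weight y false = (I.p y).den * (1 + I.marker y) := by
  rw [weight, mixedWeight, mixedWeight, add_add_add_comm, ← add_mul, entityWeight_true_add_false,
    marginalWeight_true_add_false (hp y)]
  ring

theorem weight_true_add_false_pos (y : Fin I.n) : 0 < I.weight y true + I.weight y false := by
  rw [weight_true_add_false hp]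
  exact Nat.mul_pos (I.p y).den_pos (by omega)

theorem digit_lt_base (b : Bool) (k : ℕ) : I.digit b k < I.base := by
  simpa [base, digit] using fixedCount_lt hp I.e I.x I.C.classifier b k

theorem count_mod_eq_digit {k : ℕ} (hk : k < I.n) :
    I.count % I.base ^ I.n / I.base ^ k % I.base = I.digit false k := by
  rw [count_eq, Nat.add_mul_mod_self_left, Nat.mod_eq_of_lt (sum_mul_pow_lt (digit_lt_base hp _) _),
    sum_mul_pow_div_mod (digit_lt_base hp _) hk]

theorem count_div_eq_digit {k : ℕ} (hk : k < I.n) :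
    I.count / I.base ^ I.n / I.base ^ k % I.base = I.digit true k := by
  rw [count_eq, Nat.add_mul_div_left _ _ (pow_pos I.base_pos _),
    Nat.div_eq_of_lt (sum_mul_pow_lt (digit_lt_base hp _) _), zero_add,
    sum_mul_pow_div_mod (digit_lt_base hp _) hk]

theorem score_eq_div :
    I.score = ((I.scorePart true : ℚ) - (I.scorePart false : ℚ)) / (I.scoreDen : ℚ) := by
  rw [score, shapScore_eq_div hp]
  simp only [Fintype.card_fin, scorePart, scoreDen, digit, Finset.sum_range]

theorem encodeRat_score : encodeRat I.score =
    [if I.scorePart true < I.scorePart false then 1 else 0,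
      I.scoreNum / Nat.gcd I.scoreNum I.scoreDen, I.scoreDen / Nat.gcd I.scoreNum I.scoreDen] := by
  rw [score_eq_div hp, encodeRat_sub_div _ _ I.scoreDen_pos]
  rfl

theorem scorePart_le (b : Bool) :
    I.scorePart b ≤ I.n * (I.n.factorial * I.n.factorial * I.base) := by
  calc I.scorePart b ≤ ∑ _k : Fin I.n, I.n.factorial * I.n.factorial * I.base :=
        Finset.sum_le_sum fun k _ => Nat.mul_le_mul (Nat.mul_le_mul (Nat.factorial_le k.2.le)
          (Nat.factorial_le (by omega))) (digit_lt_base hp b k).le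
    _ = I.n * (I.n.factorial * I.n.factorial * I.base) := by simp

theorem scoreNum_le : I.scoreNum ≤ I.n * (I.n.factorial * I.n.factorial * I.base) := by
  have htrue := scorePart_le hp true
  have hfalse := scorePart_le hp false
  rw [scoreNum]
  omega

theorem total_eq_prod : I.total = ∏ y, (I.p y).den * (1 + I.marker y) :=
  Finset.prod_congr (s₂ := Finset.univ) rfl fun y _ => weight_true_add_false hp y

theorem total_pos : 0 < I.total :=
  Finset.prod_pos (s := Finset.univ) fun y _ => weight_true_add_false_pos hp y

end ShapInput

/-- All numbers in the computation are below `2 ^ L`, and all loops have at most `L` iterations. -/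
structure ShapInput.Fits (I : ShapInput) (L : ℕ) : Prop where
  n_le : I.n ≤ L
  m_le : I.m ≤ L
  base_pow_lt : I.base ^ I.n < 2 ^ L
  factorial_lt : I.n.factorial < 2 ^ L
  total_lt : I.total < 2 ^ L
  total_pow_lt : I.total ^ I.m < 2 ^ L
  mul_total_lt : I.m * I.total < 2 ^ L
  score_lt : (I.n * (I.n.factorial * I.n.factorial * I.base) + I.scoreDen) * I.scoreDen < 2 ^ L

namespace ShapInput.Fits

variable {I : ShapInput} {L : ℕ} (hL : I.Fits L)

include hL

theorem base_lt : I.base < 2 ^ L := I.base_le_pow.trans_lt hL.base_pow_lt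

theorem commonDen_lt : commonDen I.p < 2 ^ L :=
  (Nat.le_mul_of_pos_left _ (by positivity)).trans_lt hL.base_lt

end ShapInput.Fits

/-! ## The program -/

namespace ShapProgram

open RamExpr RamProg

-- The input and output arrays, the arrays with the results of the stages of the program in the
-- order in which they are computed, and registers for intermediate results.
abbrev tape : ℕ := 0
abbrev output : ℕ := 1
abbrev commonDenominator : ℕ := 2
abbrev base : ℕ := 3
abbrev factorials : ℕ := 4
abbrev powers : ℕ := 5
abbrev total : ℕ := 6
abbrev counts : ℕ := 7
abbrev count : ℕ := 8
abbrev positive : ℕ := 9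
abbrev negative : ℕ := 10
abbrev commonDivisor : ℕ := 11
abbrev feature : ℕ := 12
abbrev round : ℕ := 13
abbrev gate : ℕ := 14
abbrev input : ℕ := 15
abbrev product : ℕ := 16
abbrev totalPower : ℕ := 17
abbrev sum : ℕ := 18
abbrev outdegree : ℕ := 19
abbrev divisor : ℕ := 20
abbrev remainder : ℕ := 21

/-- The number of features. -/
def nE : RamExpr := read tape (lit 1)

/-- The number of gates. -/
def mE : RamExpr := read tape (lit 2)

/-- The first number in the encoding of the label of the gate `g`. -/
def tagE (g : RamExpr) : RamExpr := read tape (add (lit 3) (add (mul (lit 2) g) (lit 0)))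

/-- The second number in the encoding of the label of the gate `g`. -/
def argE (g : RamExpr) : RamExpr := read tape (add (lit 3) (add (mul (lit 2) g) (lit 1)))

/-- Whether there is an edge from `g` to `h`. -/
def wireE (g h : RamExpr) : RamExpr :=
  read tape (add (lit 3) (add (mul (lit 2) mE) (add (mul mE g) h)))

/-- The number at position `i` of the part of the input after the circuit. -/
def tailE (i : RamExpr) : RamExpr :=
  read tape (add (lit 3) (add (mul (lit 2) mE) (add (mul mE mE) i)))

/-- The numerator of the marginal of `y`. -/
def numE (y : RamExpr) : RamExpr := tailE (add (mul (lit 3) y) (lit 1))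

/-- The denominator of the marginal of `y`. -/
def denE (y : RamExpr) : RamExpr := tailE (add (mul (lit 3) y) (lit 2))

/-- The value of the entity at `y`. -/
def entityE (y : RamExpr) : RamExpr := tailE (add (mul (lit 3) nE) y)

/-- The feature whose score is computed. -/
def featureE : RamExpr := tailE (add (mul (lit 3) nE) nE)

section TapeValues

variable {I : ShapInput} {σ : RamMemory} (hσ : σ tape = I.tape)

include hσ

theorem value_nE : nE.value σ = I.n := by simp [nE, hσ, I.tape_one]

theorem value_mE : mE.value σ = I.m := by simp [mE, hσ, I.tape_two]

theorem value_tagE {a : RamExpr} {g : Fin I.m} (hg : a.value σ = g) :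
    (tagE a).value σ = (I.C.label g).encode.getD 0 0 := by
  rw [← I.tape_label g zero_lt_two]
  simp [tagE, hσ, hg]

theorem value_argE {a : RamExpr} {g : Fin I.m} (hg : a.value σ = g) :
    (argE a).value σ = (I.C.label g).encode.getD 1 0 := by
  rw [← I.tape_label g one_lt_two]
  simp [argE, hσ, hg]

theorem value_wireE {a b : RamExpr} {g h : Fin I.m} (hg : a.value σ = g) (hh : b.value σ = h) :
    (wireE a b).value σ = (I.C.wire g h).toNat := by
  simp [wireE, value_mE hσ, hσ, hg, hh, ← I.tape_wire]

theorem value_tailE (a : RamExpr) :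
    (tailE a).value σ = I.tape (3 + (2 * I.m + (I.m * I.m + a.value σ))) := by
  simp [tailE, value_mE hσ, hσ]

theorem value_numE {a : RamExpr} {y : Fin I.n} (hy : a.value σ = y) :
    (numE a).value σ = (I.p y).num.natAbs := by
  rw [numE, value_tailE hσ, value_add, value_mul, value_lit, value_lit, hy,
    I.tape_marginal y (by norm_num)]
  rfl

theorem value_denE {a : RamExpr} {y : Fin I.n} (hy : a.value σ = y) :
    (denE a).value σ = (I.p y).den := by
  rw [denE, value_tailE hσ, value_add, value_mul, value_lit, value_lit, hy,
    I.tape_marginal y (by norm_num)]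
  rfl

theorem value_entityE {a : RamExpr} {y : Fin I.n} (hy : a.value σ = y) :
    (entityE a).value σ = (I.e y).toNat := by
  rw [entityE, value_tailE hσ, value_add, value_mul, value_lit, value_nE hσ, hy, I.tape_entity]

theorem value_featureE : featureE.value σ = I.x := by
  rw [featureE, value_tailE hσ, value_add, value_mul, value_lit, value_nE hσ, I.tape_feature]

end TapeValues

variable {I : ShapInput} {L : ℕ} {σ τ : RamMemory} {l : List ℕ}

/-- The specification of the array `k` after the stage of the program that computes it, by its
final content `a`. There is none for the output and for the intermediate results. -/
def IsResult (I : ShapInput) (k : ℕ) (a : ℕ → ℕ) : Prop :=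
  match k with
  | 0 => a = I.tape
  | 2 => a 0 = commonDen I.p
  | 3 => a 0 = I.base
  | 4 => ∀ i ≤ I.n, a i = i.factorial
  | 5 => ∀ i ≤ I.n, a i = I.base ^ i
  | 6 => a 0 = I.total
  | 7 => ∀ g : Fin I.m, a g = I.C.gateCount I.weight g
  | 8 => a 0 = I.count
  | 9 => a 0 = I.scorePart true
  | 10 => a 0 = I.scorePart false
  | 11 => a 0 = Nat.gcd I.scoreNum I.scoreDen
  | _ => True

/-- The stages of the program that compute the arrays before array `K` are complete. -/
def Computed (I : ShapInput) (K : ℕ) (σ : RamMemory) : Prop := ∀ k < K, IsResult I k (σ k)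

namespace Computed

variable {K M : ℕ}

theorem mono (h : Computed I K σ) (hM : M ≤ K := by decide) : Computed I M σ :=
  fun k hk => h k (hk.trans_le hM)

theorem of_frame (h : Computed I K σ) (hτ : ∀ k ∉ l, τ k = σ k)
    (hl : ∀ k < K, k ∈ l → k = output := by decide) : Computed I K τ := fun k hk => by
  by_cases hkl : k ∈ l
  · rw [hl k hk hkl]
    trivial
  · rw [hτ k hkl]
    exact h k hk

theorem runs {c : RamProg} (h : Computed I K σ) (hc : Runs L c σ fun τ => IsResult I K (τ K))
    (hl : ∀ k < K, k ∈ c.writes → k = output := by decide) : Runs L c σ (Computed I (K + 1)) :=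
  hc.mono fun _ hτ hK k hk => (Nat.lt_succ_iff_lt_or_eq.1 hk).elim (h.of_frame hτ hl k)
    fun hk => hk ▸ hK

theorem tape_eq (h : Computed I K σ) (hK : tape < K := by decide) : σ tape = I.tape := h _ hK

theorem commonDen_eq (h : Computed I K σ) (hK : commonDenominator < K := by decide) :
    σ commonDenominator 0 = commonDen I.p := h _ hK

theorem base_eq (h : Computed I K σ) (hK : base < K := by decide) : σ base 0 = I.base := h _ hK

theorem factorial_eq (h : Computed I K σ) {i : ℕ} (hi : i ≤ I.n)
    (hK : factorials < K := by decide) : σ factorials i = i.factorial := h _ hK i hi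

theorem pow_eq (h : Computed I K σ) {i : ℕ} (hi : i ≤ I.n) (hK : powers < K := by decide) :
    σ powers i = I.base ^ i := h _ hK i hi

theorem total_eq (h : Computed I K σ) (hK : total < K := by decide) : σ total 0 = I.total :=
  h _ hK

theorem gateCount_eq (h : Computed I K σ) (g : Fin I.m) (hK : counts < K := by decide) :
    σ counts g = I.C.gateCount I.weight g := h _ hK g

theorem count_eq (h : Computed I K σ) (hK : count < K := by decide) : σ count 0 = I.count :=
  h _ hK

theorem positive_eq (h : Computed I K σ) (hK : positive < K := by decide) :
    σ positive 0 = I.scorePart true := h _ hK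

theorem negative_eq (h : Computed I K σ) (hK : negative < K := by decide) :
    σ negative 0 = I.scorePart false := h _ hK

theorem commonDivisor_eq (h : Computed I K σ) (hK : commonDivisor < K := by decide) :
    σ commonDivisor 0 = Nat.gcd I.scoreNum I.scoreDen := h _ hK

end Computed

/-! ### Products over the features -/

/-- Compute the common denominator of the marginals. -/
def storeCommonDen : RamProg := prodLoop feature nE commonDenominator (denE (reg feature))

/-- Compute the base of the digits. -/
def storeBase : RamProg := prodLoop feature nE base (mul (lit 2) (denE (reg feature)))

/-- Compute the factorials up to that of the number of features. -/
def storeFactorials : RamProg :=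
  table feature nE factorials (lit 1)
    (mul (add (reg feature) (lit 1)) (read factorials (reg feature)))

/-- Compute the powers of the base up to the number of features. -/
def storePowers : RamProg :=
  table feature nE powers (lit 1) (mul (read powers (reg feature)) (reg base))

/-- `1` if the values of `a` and `b` are equal, and `0` otherwise. -/
def eqE (a b : RamExpr) : RamExpr := sub (lit 1) (add (sub a b) (sub b a))

/-- The factor that marks that `y` is fixed. -/
def markerE (y : RamExpr) : RamExpr :=
  add (reg base) (mul (eqE y featureE) (sub (read powers nE) (reg base)))

/-- Compute the weighted number of all entities. -/
def storeTotal : RamProg :=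
  prodLoop feature nE total (mul (denE (reg feature)) (add (lit 1) (markerE (reg feature))))

theorem value_eqE (a b : RamExpr) :
    (eqE a b).value σ = if a.value σ = b.value σ then 1 else 0 := by
  simp only [eqE, value_sub, value_lit, value_add]
  split_ifs <;> omega

theorem value_markerE (h : Computed I total σ) {a : RamExpr} {y : Fin I.n} (hy : a.value σ = y) :
    (markerE a).value σ = I.marker y := by
  rw [markerE, value_add, value_reg, value_mul, value_eqE, value_sub, value_read, value_reg,
    value_nE h.tape_eq, value_featureE h.tape_eq, hy, h.base_eq, h.pow_eq le_rfl,
    ShapInput.marker, if_congr Fin.val_inj rfl rfl]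
  have := I.base_le_pow
  split_ifs <;> omega

theorem prod_lt_of_prod_univ_lt {ι : Type*} [Fintype ι] {f : ι → ℕ} {N : ℕ} (hf : ∀ i, 0 < f i)
    (hlt : ∏ i, f i < N) (s : Finset ι) : ∏ i ∈ s, f i < N :=
  (Finset.prod_le_univ_prod_of_one_le' hf).trans_lt hlt

theorem runs_storeCommonDen (hL : I.Fits L) (h : Computed I commonDenominator σ) :
    Runs L storeCommonDen σ (Computed I base) :=
  h.runs <| Runs.prodLoop (fun y => (I.p y).den) hL.n_le (by decide)
    (fun τ hτ => value_nE (h.of_frame hτ).tape_eq)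
    (fun y τ hτ hy => value_denE (h.of_frame hτ).tape_eq hy)
    (prod_lt_of_prod_univ_lt (fun y => (I.p y).den_pos) hL.commonDen_lt)

theorem runs_storeBase (hL : I.Fits L) (h : Computed I base σ) :
    Runs L storeBase σ (Computed I factorials) := by
  refine h.runs <| (Runs.prodLoop (fun y => 2 * (I.p y).den) hL.n_le (by decide)
    (fun τ hτ => value_nE (h.of_frame hτ).tape_eq) (fun y τ hτ hy => ?_)
    (prod_lt_of_prod_univ_lt (fun y => by have := (I.p y).den_pos; omega)
      (I.prod_two_mul_den ▸ hL.base_lt))).mono fun τ _ hτ => hτ.trans I.prod_two_mul_den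
  have hfeature : (reg feature).value τ = y := hy
  rw [value_mul, value_lit, value_denE (h.of_frame hτ).tape_eq hfeature]

theorem runs_storeFactorials (hL : I.Fits L) (h : Computed I factorials σ) :
    Runs L storeFactorials σ (Computed I powers) := by
  refine h.runs <| Runs.table Nat.factorial hL.n_le (by decide)
    (fun τ hτ => value_nE (h.of_frame hτ).tape_eq) rfl
    (fun i hi => (Nat.factorial_le hi).trans_lt hL.factorial_lt) fun i _ τ _ hi hfac => ?_
  simp [hi, hfac, Nat.factorial_succ]

theorem runs_storePowers (hL : I.Fits L) (h : Computed I powers σ) :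
    Runs L storePowers σ (Computed I total) := by
  refine h.runs <| Runs.table (I.base ^ ·) hL.n_le (by decide)
    (fun τ hτ => value_nE (h.of_frame hτ).tape_eq) rfl
    (fun i hi => (Nat.pow_le_pow_right I.base_pos hi).trans_lt hL.base_pow_lt)
    fun i _ τ hτ hi hpow => ?_
  simp [hi, hpow, (h.of_frame hτ).base_eq, pow_succ]

theorem runs_storeTotal (hp : ∀ y, 0 ≤ I.p y ∧ I.p y ≤ 1) (hL : I.Fits L)
    (h : Computed I total σ) : Runs L storeTotal σ (Computed I counts) := by
  refine h.runs <| (Runs.prodLoop (fun y => (I.p y).den * (1 + I.marker y)) hL.n_le (by decide)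
    (fun τ hτ => value_nE (h.of_frame hτ).tape_eq) (fun y τ hτ hy => ?_)
    (prod_lt_of_prod_univ_lt (fun y => Nat.mul_pos (I.p y).den_pos (by omega))
      (ShapInput.total_eq_prod hp ▸ hL.total_lt))).mono
    fun τ _ hτ => hτ.trans (ShapInput.total_eq_prod hp).symm
  have hfeature : (reg feature).value τ = y := hy
  rw [value_mul, value_denE (h.of_frame hτ).tape_eq hfeature, value_add, value_lit,
    value_markerE (h.of_frame hτ) hfeature]

/-! ### Evaluation of the circuit -/

/-- The value of `a` if the gate in register `input` is an input of that in register `gate`, and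
`1` otherwise. -/
def inputFactorE (a : RamExpr) : RamExpr :=
  add (sub (lit 1) (wireE (reg input) (reg gate))) (mul (wireE (reg input) (reg gate)) a)

/-- Compute the product and the sum of the counts of the inputs of the gate in register `gate`,
and the power of the total weight that enters the rule for conjunctions. -/
def combineInputs : RamProg :=
  seq (prodLoop input mE product (inputFactorE (read counts (reg input))))
    (seq (prodLoop input mE totalPower (inputFactorE (reg total)))
      (sumLoop input mE sum (mul (wireE (reg input) (reg gate)) (read counts (reg input)))))

/-- The total weight times the marginal probability of the variable `y` under the weights. -/
def varCountE (y : RamExpr) : RamExpr :=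
  div (mul (reg total) (add (mul (mul (entityE y) (denE y)) (markerE y)) (numE y)))
    (mul (denE y) (add (lit 1) (markerE y)))

/-- The rules for the count of the gate in register `gate`, for each of the labels. -/
def gateCountE : List RamExpr :=
  [varCountE (argE (reg gate)),
    mul (reg total) (argE (reg gate)),
    div (mul (reg total) (reg product)) (reg totalPower),
    sub (reg total) (sub (reg total) (reg sum)),
    sub (reg total) (reg sum)]

/-- Update the count of the gate in register `gate`. -/
def storeGateCount : RamProg :=
  switch (tagE (reg gate)) (gateCountE.map (write counts (reg gate)))

/-- In as many rounds as there are gates, update the counts of all gates. -/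
def storeCounts : RamProg :=
  seq (table gate mE counts (lit 0) (lit 0))
    (forLoop round mE (forLoop gate mE (seq combineInputs storeGateCount)))

theorem value_inputFactorE (hσ : σ tape = I.tape) {g h : Fin I.m} (hg : σ gate 0 = g)
    (hh : σ input 0 = h) (a : RamExpr) :
    (inputFactorE a).value σ = if I.C.wire h g = true then a.value σ else 1 := by
  have hwire : (wireE (reg input) (reg gate)).value σ = (I.C.wire h g).toNat :=
    value_wireE hσ hh hg
  cases hw : I.C.wire h g <;> simp [inputFactorE, hwire, hw]

theorem runs_prodLoop_inputFactorE (hp : ∀ y, 0 ≤ I.p y ∧ I.p y ≤ 1) (hL : I.Fits L)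
    (h : Computed I counts σ) {g : Fin I.m} (hg : σ gate 0 = g) {k : ℕ} (hk : input < k)
    {a : RamExpr} {f : Fin I.m → ℕ} (hf : ∀ i, f i ≤ I.total)
    (ha : ∀ i : Fin I.m, ∀ τ : RamMemory, (∀ j ∉ [input, k], τ j = σ j) → τ input 0 = i →
      a.value τ = f i) :
    Runs L (prodLoop input mE k (inputFactorE a)) σ fun τ =>
      τ k 0 = ∏ i ∈ I.C.inputs g, f i := by
  have hframe : ∀ j < input, j ∉ [input, k] := fun j hj => by simp [hj.ne, (hj.trans hk).ne]
  have htape : ∀ τ : RamMemory, (∀ j ∉ [input, k], τ j = σ j) → τ tape = I.tape := fun τ hτ =>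
    (hτ tape (hframe _ (by decide))).trans h.tape_eq
  refine (Runs.prodLoop (fun i => if I.C.wire i g = true then f i else 1) hL.m_le hk.ne
    (fun τ hτ => value_mE (htape τ hτ)) (fun i τ hτ hi => ?_) fun s => ?_).mono
    fun τ _ hτ => by rw [hτ, BooleanCircuit.inputs, Finset.prod_filter]
  · have hg' : τ gate 0 = g := by rw [hτ gate (hframe _ (by decide)), hg]
    rw [value_inputFactorE (htape τ hτ) hg' hi, ha i τ hτ hi]
  · have htotal := ShapInput.total_pos hp
    have hcard : s.card ≤ I.m := by simpa using s.card_le_univ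
    calc ∏ i ∈ s, (if I.C.wire i g = true then f i else 1) ≤ I.total ^ s.card :=
          Finset.prod_le_pow_card _ _ _ fun i _ => by split_ifs; exacts [hf i, htotal]
      _ ≤ I.total ^ I.m := Nat.pow_le_pow_right htotal hcard
      _ < 2 ^ L := hL.total_pow_lt

theorem runs_combineInputs (hp : ∀ y, 0 ≤ I.p y ∧ I.p y ≤ 1) (hL : I.Fits L)
    (h : Computed I counts σ) {g : Fin I.m} (hg : σ gate 0 = g)
    (hle : ∀ i : Fin I.m, σ counts i ≤ I.total) :
    Runs L combineInputs σ fun τ => τ product 0 = ∏ i ∈ I.C.inputs g, σ counts i ∧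
      τ totalPower 0 = I.total ^ (I.C.inputs g).card ∧
      τ sum 0 = ∑ i ∈ I.C.inputs g, σ counts i := by
  refine Runs.seq (runs_prodLoop_inputFactorE hp hL h hg (by decide) hle fun i τ hτ hi => by
    rw [value_read, value_reg, hi, hτ counts (by decide)]) fun τ₁ h₁ hproduct => ?_
  have hg₁ : τ₁ gate 0 = g := by rw [h₁ gate (by decide), hg]
  replace h := h.of_frame h₁
  refine Runs.seq (runs_prodLoop_inputFactorE hp hL h hg₁ (by decide) (fun _ => le_rfl)
    fun i τ hτ _ => (h.of_frame hτ).total_eq) fun τ₂ h₂ hpower => ?_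
  have hg₂ : τ₂ gate 0 = g := by rw [h₂ gate (by decide), hg₁]
  have hcounts : τ₂ counts = σ counts := by rw [h₂ counts (by decide), h₁ counts (by decide)]
  replace h := h.of_frame h₂
  refine (Runs.sumLoop (fun i => if I.C.wire i g = true then σ counts i else 0) hL.m_le (by decide)
    (fun τ hτ => value_mE (h.of_frame hτ).tape_eq) (fun i τ hτ hi => ?_) ?_).mono
    fun τ₃ h₃ hsum => ⟨?_, ?_, ?_⟩
  · have hwire : (wireE (reg input) (reg gate)).value τ = (I.C.wire i g).toNat :=
      value_wireE (h.of_frame hτ).tape_eq hi (by rw [value_reg, hτ gate (by decide), hg₂])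
    rw [value_mul, hwire, value_read, value_reg, hi, hτ counts (by decide), hcounts]
    cases I.C.wire i g <;> simp
  · calc ∑ i, (if I.C.wire i g = true then σ counts i else 0) ≤ ∑ _i : Fin I.m, I.total :=
          Finset.sum_le_sum fun i _ => by split_ifs; exacts [hle i, Nat.zero_le _]
      _ = I.m * I.total := by simp
      _ < 2 ^ L := hL.mul_total_lt
  · rw [h₃ product (by decide), h₂ product (by decide), hproduct]
  · rw [h₃ totalPower (by decide), hpower, Finset.prod_const]
  · rw [hsum, BooleanCircuit.inputs, Finset.sum_filter]

theorem value_varCountE (hp : ∀ y, 0 ≤ I.p y ∧ I.p y ≤ 1) (h : Computed I counts σ)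
    {a : RamExpr} {y : Fin I.n} (hy : a.value σ = y) :
    (varCountE a).value σ =
      I.total * I.weight y true / (I.weight y true + I.weight y false) := by
  have hweight : I.weight y true =
      (I.e y).toNat * (I.p y).den * I.marker y + (I.p y).num.natAbs := by
    cases he : I.e y <;> simp [ShapInput.weight, mixedWeight, entityWeight, marginalWeight, he]
  rw [ShapInput.weight_true_add_false hp, hweight]
  simp only [varCountE, value_div, value_mul, value_add, value_reg, value_lit, h.total_eq,
    value_entityE h.tape_eq hy, value_denE h.tape_eq hy, value_numE h.tape_eq hy,
    value_markerE h.mono hy]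

theorem runs_storeGateCount (hp : ∀ y, 0 ≤ I.p y ∧ I.p y ≤ 1) (hL : I.Fits L)
    (h : Computed I counts σ) {g : Fin I.m} (hg : σ gate 0 = g) {c : Fin I.m → ℕ}
    (hle : ∀ i, c i ≤ I.total) (hproduct : σ product 0 = ∏ i ∈ I.C.inputs g, c i)
    (hpower : σ totalPower 0 = I.total ^ (I.C.inputs g).card)
    (hsum : σ sum 0 = ∑ i ∈ I.C.inputs g, c i) :
    Runs L storeGateCount σ fun τ =>
      τ counts = Function.update (σ counts) g (I.C.updatedCount I.weight c g) := by
  suffices ∃ i a, (tagE (reg gate)).value σ = i ∧ gateCountE[i]? = some a ∧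
      a.value σ = I.C.updatedCount I.weight c g by
    obtain ⟨i, a, hi, ha, hval⟩ := this
    rw [← hg, ← hval]
    exact Runs.switch hi (by rw [List.getElem?_map, ha, Option.map_some]) (Runs.write_array
      (hval ▸ (I.C.updatedCount_le I.weight hle g).trans_lt hL.total_lt))
  have htag := value_tagE h.tape_eq (a := reg gate) hg
  have harg := value_argE h.tape_eq (a := reg gate) hg
  have htotal : σ total 0 = totalWeight I.weight := h.total_eq
  rw [htag, BooleanCircuit.updatedCount]
  cases hlabel : I.C.label g with
  | var y =>
    exact ⟨0, _, rfl, rfl, value_varCountE hp h (by rw [harg, hlabel]; rfl)⟩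
  | const b =>
    refine ⟨1, _, rfl, rfl, ?_⟩
    rw [value_mul, value_reg, harg, hlabel, htotal]
    rfl
  | and =>
    refine ⟨2, _, rfl, rfl, ?_⟩
    rw [value_div, value_mul, value_reg, value_reg, value_reg, htotal, hproduct, hpower]
    rfl
  | or =>
    refine ⟨3, _, rfl, rfl, ?_⟩
    rw [value_sub, value_sub, value_reg, value_reg, htotal, hsum, tsub_tsub_eq_min]
  | not =>
    refine ⟨4, _, rfl, rfl, ?_⟩
    rw [value_sub, value_reg, value_reg, htotal, hsum]

/-- In round `t`, after the update of the gates below `i`, the candidates `a` for the counts are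
correct up to rank `t` for the updated gates, and below rank `t` for all gates. -/
def CorrectCounts (I : ShapInput) (t i : ℕ) (a : ℕ → ℕ) : Prop :=
  ∀ g : Fin I.m, a g ≤ I.total ∧
    (I.C.rank g < t ∨ g.val < i ∧ I.C.rank g ≤ t → a g = I.C.gateCount I.weight g)

theorem CorrectCounts.update (hI : I ∈ shapInstances) {t i : ℕ} (hi : i < I.m) {a : ℕ → ℕ}
    (ha : CorrectCounts I t i a) :
    CorrectCounts I t (i + 1)
      (Function.update a i (I.C.updatedCount I.weight (fun g => a g) ⟨i, hi⟩)) := by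
  intro g
  obtain rfl | hg := eq_or_ne g ⟨i, hi⟩
  · rw [Function.update_self]
    refine ⟨I.C.updatedCount_le _ (fun g => (ha g).1) _, fun hrank => ?_⟩
    refine I.C.updatedCount_eq_gateCount hI.1 hI.2.1
      (ShapInput.weight_true_add_false_pos hI.2.2) fun h hw => (ha h).2 (.inl ?_)
    have := I.C.rank_lt_rank hw
    omega
  · have hgi : g.val ≠ i := fun h => hg (Fin.ext h)
    rw [Function.update_of_ne hgi]
    refine ⟨(ha g).1, fun hrank => (ha g).2 ?_⟩
    omega

theorem CorrectCounts.next_round {t : ℕ} {a : ℕ → ℕ} (ha : CorrectCounts I t I.m a) :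
    CorrectCounts I (t + 1) 0 a := fun g =>
  ⟨(ha g).1, fun hrank => (ha g).2 (.inr ⟨g.2, by omega⟩)⟩

theorem runs_storeCounts (hI : I ∈ shapInstances) (hL : I.Fits L) (h : Computed I counts σ) :
    Runs L storeCounts σ (Computed I count) := by
  refine h.runs <| Runs.seq (Runs.table (fun _ => 0) hL.m_le (by decide)
    (fun τ hτ => value_mE (h.of_frame hτ).tape_eq) rfl (by simp) (by simp)) fun τ₁ h₁ hzero => ?_
  replace h := h.of_frame h₁
  have hinit : CorrectCounts I 0 0 (τ₁ counts) := fun g => by simp [hzero g g.2.le]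
  refine (Runs.forLoop (fun t => CorrectCounts I t 0) hL.m_le (by decide) (by decide)
    (fun τ hτ => value_mE (h.of_frame hτ).tape_eq) hinit fun t _ τ₂ h₂ _ ht => ?_).mono
    fun τ _ hτ g => (hτ g).2 (.inl (by simpa using I.C.rank_lt_card g))
  replace h := h.of_frame h₂
  refine (Runs.forLoop (CorrectCounts I t) hL.m_le (by decide) (by decide)
    (fun τ hτ => value_mE (h.of_frame hτ).tape_eq) ht fun i hi τ₃ h₃ hgate hcorrect => ?_).mono
    fun τ _ hτ => hτ.next_round
  replace h := h.of_frame h₃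
  have hle : ∀ g : Fin I.m, τ₃ counts g ≤ I.total := fun g => (hcorrect g).1
  refine Runs.seq (runs_combineInputs hI.2.2 hL h (g := ⟨i, hi⟩) hgate hle)
    fun τ₄ h₄ ⟨hproduct, hpower, hsum⟩ => ?_
  refine (runs_storeGateCount hI.2.2 hL (h.of_frame h₄) (by rwa [h₄ gate (by decide)]) hle
    hproduct hpower hsum).mono fun τ _ hτ => ?_
  rw [hτ, h₄ counts (by decide)]
  exact hcorrect.update hI hi

/-- Look up the count of the output gate, which is the gate without outgoing edges. -/
def storeCount : RamProg :=
  forLoop gate mE (seq (sumLoop input mE outdegree (wireE (reg gate) (reg input)))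
    (branch (reg outdegree) skip (assign count (read counts (reg gate)))))

theorem runs_storeCount (hL : I.Fits L) (h : Computed I count σ) :
    Runs L storeCount σ (Computed I positive) := by
  refine h.runs <| (Runs.forLoop (fun i a => I.C.output.val < i → a 0 = I.count) hL.m_le
    (by decide) (by decide) (fun τ hτ => value_mE (h.of_frame hτ).tape_eq) (by simp)
    fun i hi τ₁ h₁ hgate hcount => ?_).mono fun τ _ hτ => hτ I.C.output.2
  replace h := h.of_frame h₁
  refine Runs.seq (Runs.sumLoop (fun g => (I.C.wire ⟨i, hi⟩ g).toNat) hL.m_le (by decide)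
    (fun τ hτ => value_mE (h.of_frame hτ).tape_eq) (fun g τ hτ hg => ?_) ?_)
    fun τ₂ h₂ houtdegree => ?_
  · exact value_wireE (h.of_frame hτ).tape_eq (by rwa [value_reg, hτ gate (by decide)]) hg
  · calc ∑ g, (I.C.wire ⟨i, hi⟩ g).toNat ≤ ∑ _g : Fin I.m, 1 :=
          Finset.sum_le_sum fun g _ => Bool.toNat_le _
      _ = I.m := by simp
      _ < 2 ^ L := hL.m_le.trans_lt Nat.lt_two_pow_self
  replace h := h.of_frame h₂
  refine Runs.branch (fun hpos => Runs.skip fun hlt => ?_) fun hzero => ?_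
  · rw [h₂ count (by decide)]
    refine hcount (lt_of_le_of_ne (Nat.lt_succ_iff.1 hlt) fun heq => hpos ?_)
    rw [value_reg, houtdegree, BooleanCircuit.sum_toNat_wire_eq_zero_iff]
    exact Fin.ext heq.symm
  · rw [value_reg, houtdegree, BooleanCircuit.sum_toNat_wire_eq_zero_iff] at hzero
    have hval : (read counts (reg gate)).value τ₂ = I.count := by
      rw [value_read, value_reg, h₂ gate (by decide), hgate, h.gateCount_eq ⟨i, hi⟩, hzero]
      rfl
    refine (Runs.assign ?_).mono fun τ _ hτ _ => hτ.trans hval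
    rw [hval]
    exact (weightedCount_le_totalWeight _ _).trans_lt hL.total_lt

/-! ### Extraction of the score -/

/-- The term of a part of the score with the digit at the position in register `feature` of the
number `a`. -/
def termE (a : RamExpr) : RamExpr :=
  mul (mul (read factorials (reg feature))
    (read factorials (sub (sub nE (lit 1)) (reg feature))))
    (mod (div a (read powers (reg feature))) (reg base))

/-- Compute the sum of the positive terms of the score. -/
def storePositive : RamProg :=
  sumLoop feature nE positive (termE (div (reg count) (read powers nE)))

/-- Compute the sum of the absolute values of the negative terms of the score. -/
def storeNegative : RamProg :=
  sumLoop feature nE negative (termE (mod (reg count) (read powers nE)))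

theorem value_termE (h : Computed I positive σ) (a : RamExpr) {k : Fin I.n}
    (hk : σ feature 0 = k) : (termE a).value σ =
      k.val.factorial * (I.n - 1 - k).factorial * (a.value σ / I.base ^ k.val % I.base) := by
  rw [termE, value_mul, value_mul, value_mod, value_div, value_read, value_read, value_read,
    value_sub, value_sub, value_lit, value_reg, value_reg, value_nE h.tape_eq, hk, h.base_eq,
    h.factorial_eq k.2.le, h.factorial_eq (by omega), h.pow_eq k.2.le]

theorem scorePart_lt (hp : ∀ y, 0 ≤ I.p y ∧ I.p y ≤ 1) (hL : I.Fits L) (b : Bool) :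
    I.scorePart b < 2 ^ L :=
  calc I.scorePart b ≤ I.n * (I.n.factorial * I.n.factorial * I.base) + I.scoreDen :=
        (ShapInput.scorePart_le hp b).trans (Nat.le_add_right _ _)
    _ ≤ _ := Nat.le_mul_of_pos_right _ I.scoreDen_pos
    _ < 2 ^ L := hL.score_lt

theorem runs_storePositive (hp : ∀ y, 0 ≤ I.p y ∧ I.p y ≤ 1) (hL : I.Fits L)
    (h : Computed I positive σ) : Runs L storePositive σ (Computed I negative) := by
  refine h.runs <| Runs.sumLoop _ hL.n_le (by decide)
    (fun τ hτ => value_nE (h.of_frame hτ).tape_eq) (fun k τ hτ hk => ?_) (scorePart_lt hp hL true)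
  replace h := h.of_frame hτ
  rw [value_termE h _ hk, value_div, value_read, value_nE h.tape_eq, value_reg, h.count_eq,
    h.pow_eq le_rfl, ShapInput.count_div_eq_digit hp k.2]

theorem runs_storeNegative (hp : ∀ y, 0 ≤ I.p y ∧ I.p y ≤ 1) (hL : I.Fits L)
    (h : Computed I negative σ) : Runs L storeNegative σ (Computed I commonDivisor) := by
  refine h.runs <| Runs.sumLoop _ hL.n_le (by decide)
    (fun τ hτ => value_nE (h.of_frame hτ).tape_eq) (fun k τ hτ hk => ?_) (scorePart_lt hp hL false)
  replace h := h.of_frame hτ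
  rw [value_termE h.mono _ hk, value_mod, value_read, value_nE h.tape_eq, value_reg, h.count_eq,
    h.pow_eq le_rfl, ShapInput.count_mod_eq_digit hp k.2]

/-- The absolute value of the numerator of the score before reduction. -/
def scoreNumE : RamExpr :=
  add (sub (reg positive) (reg negative)) (sub (reg negative) (reg positive))

/-- The denominator of the score before reduction. -/
def scoreDenE : RamExpr := mul (reg commonDenominator) (read factorials nE)

/-- Compute the greatest common divisor of the numerator and the denominator of the score. The
denominator is added to the numerator because `euclid` expects the larger number first. -/
def storeCommonDivisor : RamProg :=
  seq (assign commonDivisor (add scoreNumE scoreDenE))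
    (seq (assign divisor scoreDenE) (euclid commonDivisor divisor remainder))

/-- Write the length and the entries of the encoding of the reduced fraction to the output. -/
def storeOutput : RamProg :=
  seq (write output (lit 0) (lit 3))
    (seq (write output (lit 1) (sub (lit 1) (sub (lit 1) (sub (reg negative) (reg positive)))))
      (seq (write output (lit 2) (div scoreNumE (reg commonDivisor)))
        (write output (lit 3) (div scoreDenE (reg commonDivisor)))))

theorem value_scoreNumE (h : Computed I commonDivisor σ) : scoreNumE.value σ = I.scoreNum := by
  simp only [scoreNumE, value_add, value_sub, value_reg, h.positive_eq, h.negative_eq,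
    ShapInput.scoreNum]

theorem value_scoreDenE (h : Computed I commonDivisor σ) : scoreDenE.value σ = I.scoreDen := by
  rw [scoreDenE, value_mul, value_reg, value_read, value_nE h.tape_eq, h.commonDen_eq,
    h.factorial_eq le_rfl, ShapInput.scoreDen]

theorem scoreNum_add_scoreDen_mul_scoreDen_lt (hp : ∀ y, 0 ≤ I.p y ∧ I.p y ≤ 1) (hL : I.Fits L) :
    (I.scoreNum + I.scoreDen) * I.scoreDen < 2 ^ L :=
  (Nat.mul_le_mul_right _ (Nat.add_le_add_right (ShapInput.scoreNum_le hp) _)).trans_lt hL.score_lt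

theorem scoreNum_add_scoreDen_lt (hp : ∀ y, 0 ≤ I.p y ∧ I.p y ≤ 1) (hL : I.Fits L) :
    I.scoreNum + I.scoreDen < 2 ^ L :=
  (Nat.le_mul_of_pos_right _ I.scoreDen_pos).trans_lt (scoreNum_add_scoreDen_mul_scoreDen_lt hp hL)

theorem runs_storeCommonDivisor (hp : ∀ y, 0 ≤ I.p y ∧ I.p y ≤ 1) (hL : I.Fits L)
    (h : Computed I commonDivisor σ) :
    Runs L storeCommonDivisor σ (Computed I feature) := by
  have hlt := scoreNum_add_scoreDen_lt hp hL
  refine h.runs <| Runs.seq (Runs.assign ?_) fun τ₁ h₁ hnum => ?_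
  · rwa [value_add, value_scoreNumE h, value_scoreDenE h]
  rw [value_add, value_scoreNumE h, value_scoreDenE h] at hnum
  replace h := h.of_frame h₁
  refine Runs.seq (Runs.assign ?_) fun τ₂ h₂ hden => ?_
  · rw [value_scoreDenE h]
    omega
  rw [value_scoreDenE h] at hden
  replace hnum : τ₂ commonDivisor 0 = I.scoreNum + I.scoreDen := by
    rw [h₂ commonDivisor (by decide), hnum]
  refine (Runs.euclid (by decide) (by decide) (by decide) (by omega) ?_).mono fun τ _ hτ => ?_
  · rw [hnum, hden]
    exact scoreNum_add_scoreDen_mul_scoreDen_lt hp hL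
  · rw [hnum, hden, Nat.gcd_add_self_left] at hτ
    exact hτ

theorem runs_storeOutput (hp : ∀ y, 0 ≤ I.p y ∧ I.p y ≤ 1) (hL : I.Fits L) (hL2 : 2 ≤ L)
    (h : Computed I feature σ) :
    Runs L storeOutput σ fun τ => RamOutput τ (encodeRat I.score) := by
  have hlt := scoreNum_add_scoreDen_lt hp hL
  have hfour : 2 ^ 2 ≤ 2 ^ L := Nat.pow_le_pow_right two_pos hL2
  refine Runs.seq (Runs.write_array (by rw [value_lit]; omega)) fun τ₁ h₁ hlength => ?_
  replace h := h.of_frame h₁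
  refine Runs.seq (Runs.write_array (by simp only [value_sub, value_lit]; omega))
    fun τ₂ h₂ hsign => ?_
  simp only [value_sub, value_lit, value_reg, h.positive_eq, h.negative_eq] at hsign
  replace h := h.of_frame h₂
  have hnum := value_scoreNumE h.mono
  refine Runs.seq (Runs.write_array ?_) fun τ₃ h₃ hnum' => ?_
  · rw [value_div, hnum]
    exact (Nat.div_le_self _ _).trans_lt (by omega)
  rw [value_div, hnum, value_reg, h.commonDivisor_eq] at hnum'
  replace h := h.of_frame h₃
  have hden := value_scoreDenE h.mono
  refine (Runs.write_array ?_).mono fun τ₄ _ hden' i hi => ?_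
  · rw [value_div, hden]
    exact (Nat.div_le_self _ _).trans_lt (by omega)
  rw [value_div, hden, value_reg, h.commonDivisor_eq] at hden'
  rw [ShapInput.encodeRat_score hp] at hi ⊢
  have hi' : i < 4 := Nat.lt_succ_iff.2 hi
  rw [hden', hnum', hsign, hlength]
  interval_cases i <;> simp [Function.update]
  split_ifs <;> omega

/-- The program that computes SHAP-scores. -/
def program : RamProg :=
  seq storeCommonDen (seq storeBase (seq storeFactorials (seq storePowers (seq storeTotal
    (seq storeCounts (seq storeCount (seq storePositive (seq storeNegative
      (seq storeCommonDivisor storeOutput)))))))))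

theorem runs_program (hI : I ∈ shapInstances) (hL : I.Fits L) (hL2 : 2 ≤ L) :
    Runs L program (ramInput I.encode) fun τ => RamOutput τ (encodeRat I.score) := by
  have hp := hI.2.2
  have hinput : Computed I commonDenominator (ramInput I.encode) := fun k hk => by
    interval_cases k
    exacts [rfl, trivial]
  exact .seq (runs_storeCommonDen hL hinput) fun _ _ h =>
    .seq (runs_storeBase hL h) fun _ _ h =>
    .seq (runs_storeFactorials hL h) fun _ _ h =>
    .seq (runs_storePowers hL h) fun _ _ h =>
    .seq (runs_storeTotal hp hL h) fun _ _ h =>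
    .seq (runs_storeCounts hI hL h) fun _ _ h =>
    .seq (runs_storeCount hL h) fun _ _ h =>
    .seq (runs_storePositive hp hL h) fun _ _ h =>
    .seq (runs_storeNegative hp hL h) fun _ _ h =>
    .seq (runs_storeCommonDivisor hp hL h) fun _ _ h => runs_storeOutput hp hL hL2 h

end ShapProgram

/-! ## Polynomial bounds -/

theorem size_succ_le_inputLength {l : List ℕ} {a : ℕ} (h : a ∈ l) :
    Nat.size a + 1 ≤ inputLength l :=
  List.single_le_sum (fun _ _ => Nat.zero_le _) _ (List.mem_map_of_mem h)

theorem length_le_inputLength (l : List ℕ) : l.length ≤ inputLength l := by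
  simp [inputLength]

theorem getD_lt_two_pow_inputLength (l : List ℕ) (i : ℕ) : l.getD i 0 < 2 ^ inputLength l := by
  by_cases h : i < l.length
  · rw [List.getD_eq_getElem _ _ h]
    exact (Nat.lt_size_self _).trans_le (Nat.pow_le_pow_right two_pos
      ((Nat.le_succ _).trans (size_succ_le_inputLength (List.getElem_mem h))))
  · rw [List.getD_eq_default _ _ (by omega)]
    positivity

theorem ramInput_lt_two_pow_inputLength (l : List ℕ) (k i : ℕ) :
    ramInput l k i < 2 ^ inputLength l := by
  rw [ramInput]
  split_ifs
  · cases i with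
    | zero => exact (length_le_inputLength l).trans_lt Nat.lt_two_pow_self
    | succ i => exact getD_lt_two_pow_inputLength l i
  · positivity

namespace ShapInput

variable (I : ShapInput)

theorem length_encode : I.encode.length = 2 + 2 * I.m + I.m * I.m + 3 * I.n + I.n + 1 := by
  simp only [encode, List.length_append, List.length_flatMap, GateLabel.length_encode,
    List.length_map, List.length_finRange, encodeRat, List.length_cons, List.length_nil,
    List.map_const', List.sum_replicate, smul_eq_mul]
  ring

theorem n_lt_inputLength : I.n < inputLength I.encode := by
  have := I.length_encode ▸ length_le_inputLength I.encode
  omega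

theorem m_le_inputLength : I.m ≤ inputLength I.encode := by
  have := I.length_encode ▸ length_le_inputLength I.encode
  omega

theorem den_le (y : Fin I.n) : (I.p y).den ≤ 2 ^ inputLength I.encode :=
  calc (I.p y).den = (encodeRat (I.p y)).getD 2 0 := rfl
    _ = _ := (I.tape_marginal y (j := 2) (by norm_num)).symm
    _ ≤ _ := (ramInput_lt_two_pow_inputLength I.encode 0 _).le

theorem commonDen_le : commonDen I.p ≤ 2 ^ inputLength I.encode ^ 2 :=
  calc commonDen I.p ≤ ∏ _y : Fin I.n, 2 ^ inputLength I.encode :=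
        Finset.prod_le_prod' fun y _ => I.den_le y
    _ = 2 ^ (inputLength I.encode * I.n) := by simp [pow_mul]
    _ ≤ 2 ^ inputLength I.encode ^ 2 := Nat.pow_le_pow_right two_pos <| by
        rw [sq]; exact Nat.mul_le_mul_left _ I.n_lt_inputLength.le

theorem base_le : I.base ≤ 2 ^ (2 * inputLength I.encode ^ 2) :=
  calc I.base ≤ 2 ^ I.n * 2 ^ inputLength I.encode ^ 2 := Nat.mul_le_mul_left _ I.commonDen_le
    _ = 2 ^ (I.n + inputLength I.encode ^ 2) := (pow_add _ _ _).symm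
    _ ≤ 2 ^ (2 * inputLength I.encode ^ 2) := Nat.pow_le_pow_right two_pos <| by
        have := Nat.le_self_pow two_ne_zero (inputLength I.encode)
        have := I.n_lt_inputLength
        omega

theorem base_pow_le : I.base ^ I.n ≤ 2 ^ (2 * inputLength I.encode ^ 3) :=
  calc I.base ^ I.n ≤ (2 ^ (2 * inputLength I.encode ^ 2)) ^ I.n := Nat.pow_le_pow_left I.base_le _
    _ = 2 ^ (2 * inputLength I.encode ^ 2 * I.n) := (pow_mul _ _ _).symm
    _ ≤ 2 ^ (2 * inputLength I.encode ^ 3) := Nat.pow_le_pow_right two_pos <| by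
        rw [pow_succ _ 2, ← mul_assoc]
        exact Nat.mul_le_mul_left _ I.n_lt_inputLength.le

theorem factorial_le : I.n.factorial ≤ 2 ^ inputLength I.encode ^ 2 :=
  calc I.n.factorial ≤ I.n ^ I.n := Nat.factorial_le_pow _
    _ ≤ (2 ^ inputLength I.encode) ^ I.n :=
        Nat.pow_le_pow_left (I.n_lt_inputLength.trans Nat.lt_two_pow_self).le _
    _ = 2 ^ (inputLength I.encode * I.n) := (pow_mul _ _ _).symm
    _ ≤ 2 ^ inputLength I.encode ^ 2 := Nat.pow_le_pow_right two_pos <| by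
        rw [sq]; exact Nat.mul_le_mul_left _ I.n_lt_inputLength.le

theorem marker_le (y : Fin I.n) : I.marker y ≤ 2 ^ (2 * inputLength I.encode ^ 3) := by
  refine le_trans ?_ I.base_pow_le
  rw [marker]
  split_ifs
  exacts [le_rfl, I.base_le_pow]

theorem den_mul_one_add_marker_le (y : Fin I.n) :
    (I.p y).den * (1 + I.marker y) ≤ 2 ^ (4 * inputLength I.encode ^ 3) := by
  have hmarker : 1 + I.marker y ≤ 2 ^ (2 * inputLength I.encode ^ 3 + 1) := by
    have := I.marker_le y
    have := Nat.one_le_two_pow (n := 2 * inputLength I.encode ^ 3)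
    omega
  calc (I.p y).den * (1 + I.marker y)
      ≤ 2 ^ inputLength I.encode * 2 ^ (2 * inputLength I.encode ^ 3 + 1) :=
        Nat.mul_le_mul (I.den_le y) hmarker
    _ = 2 ^ (inputLength I.encode + (2 * inputLength I.encode ^ 3 + 1)) := (pow_add _ _ _).symm
    _ ≤ 2 ^ (4 * inputLength I.encode ^ 3) := Nat.pow_le_pow_right two_pos <| by
        have := Nat.le_self_pow three_ne_zero (inputLength I.encode)
        have := I.n_lt_inputLength
        omega

theorem scoreDen_le : I.scoreDen ≤ 2 ^ (2 * inputLength I.encode ^ 2) :=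
  (Nat.mul_le_mul I.commonDen_le I.factorial_le).trans_eq (by rw [← pow_add, two_mul])

theorem n_mul_factorial_mul_factorial_mul_base_le : I.n * (I.n.factorial * I.n.factorial * I.base) ≤
    2 ^ (5 * inputLength I.encode ^ 2) :=
  calc I.n * (I.n.factorial * I.n.factorial * I.base)
      ≤ 2 ^ inputLength I.encode * (2 ^ inputLength I.encode ^ 2 * 2 ^ inputLength I.encode ^ 2 *
          2 ^ (2 * inputLength I.encode ^ 2)) :=
        Nat.mul_le_mul (I.n_lt_inputLength.trans Nat.lt_two_pow_self).le
          (Nat.mul_le_mul (Nat.mul_le_mul I.factorial_le I.factorial_le) I.base_le)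
    _ = 2 ^ (inputLength I.encode + 4 * inputLength I.encode ^ 2) := by ring
    _ ≤ 2 ^ (5 * inputLength I.encode ^ 2) := Nat.pow_le_pow_right two_pos <| by
        have := Nat.le_self_pow two_ne_zero (inputLength I.encode)
        omega

theorem n_mul_add_scoreDen_mul_scoreDen_le :
    (I.n * (I.n.factorial * I.n.factorial * I.base) + I.scoreDen) * I.scoreDen ≤
      2 ^ (9 * inputLength I.encode ^ 2) := by
  have hmono : 2 ^ (2 * inputLength I.encode ^ 2) ≤ 2 ^ (5 * inputLength I.encode ^ 2) :=
    Nat.pow_le_pow_right two_pos (by omega)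
  calc (I.n * (I.n.factorial * I.n.factorial * I.base) + I.scoreDen) * I.scoreDen
      ≤ (2 ^ (5 * inputLength I.encode ^ 2) + 2 ^ (5 * inputLength I.encode ^ 2)) *
          2 ^ (2 * inputLength I.encode ^ 2) :=
        Nat.mul_le_mul (Nat.add_le_add I.n_mul_factorial_mul_factorial_mul_base_le
          (I.scoreDen_le.trans hmono)) I.scoreDen_le
    _ = 2 ^ (7 * inputLength I.encode ^ 2 + 1) := by ring
    _ ≤ 2 ^ (9 * inputLength I.encode ^ 2) := Nat.pow_le_pow_right two_pos <| by
        have := Nat.pow_pos (n := 2) (Nat.zero_lt_of_lt I.n_lt_inputLength)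
        omega

variable {I} (hp : ∀ y, 0 ≤ I.p y ∧ I.p y ≤ 1)

include hp

theorem total_le : I.total ≤ 2 ^ (4 * inputLength I.encode ^ 4) := by
  rw [I.total_eq_prod hp]
  calc ∏ y, (I.p y).den * (1 + I.marker y) ≤ ∏ _y : Fin I.n, 2 ^ (4 * inputLength I.encode ^ 3) :=
        Finset.prod_le_prod' fun y _ => I.den_mul_one_add_marker_le y
    _ = 2 ^ (4 * inputLength I.encode ^ 3 * I.n) := by simp [pow_mul]
    _ ≤ 2 ^ (4 * inputLength I.encode ^ 4) := Nat.pow_le_pow_right two_pos <| by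
        rw [pow_succ _ 3, ← mul_assoc]
        exact Nat.mul_le_mul_left _ I.n_lt_inputLength.le

theorem total_pow_le : I.total ^ I.m ≤ 2 ^ (4 * inputLength I.encode ^ 5) :=
  calc I.total ^ I.m ≤ (2 ^ (4 * inputLength I.encode ^ 4)) ^ I.m :=
        Nat.pow_le_pow_left (total_le hp) _
    _ = 2 ^ (4 * inputLength I.encode ^ 4 * I.m) := (pow_mul _ _ _).symm
    _ ≤ 2 ^ (4 * inputLength I.encode ^ 5) := Nat.pow_le_pow_right two_pos <| by
        rw [pow_succ _ 4, ← mul_assoc]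
        exact Nat.mul_le_mul_left _ I.m_le_inputLength

theorem mul_total_le :
    I.m * I.total ≤ 2 ^ (inputLength I.encode + 4 * inputLength I.encode ^ 4) :=
  calc I.m * I.total ≤ 2 ^ inputLength I.encode * 2 ^ (4 * inputLength I.encode ^ 4) :=
        Nat.mul_le_mul (I.m_le_inputLength.trans Nat.lt_two_pow_self.le) (total_le hp)
    _ = 2 ^ (inputLength I.encode + 4 * inputLength I.encode ^ 4) := (pow_add _ _ _).symm

theorem fits : I.Fits (10 * inputLength I.encode ^ 5) := by
  have hn := I.n_lt_inputLength
  have hpos : 0 < inputLength I.encode ^ 5 := Nat.pow_pos (Nat.zero_lt_of_lt hn)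
  have hpow {k : ℕ} (hk : k ≤ 5) : inputLength I.encode ^ k ≤ inputLength I.encode ^ 5 :=
    Nat.pow_le_pow_right (Nat.zero_lt_of_lt hn) hk
  have hone := Nat.le_self_pow (n := 5) (by norm_num) (inputLength I.encode)
  have htwo := hpow (k := 2) (by norm_num)
  have hthree := hpow (k := 3) (by norm_num)
  have hfour := hpow (k := 4) (by norm_num)
  have hlt {a k : ℕ} (ha : a ≤ 2 ^ k) (hk : k < 10 * inputLength I.encode ^ 5) :
      a < 2 ^ (10 * inputLength I.encode ^ 5) :=
    ha.trans_lt (Nat.pow_lt_pow_right one_lt_two hk)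
  exact {
    n_le := by omega
    m_le := I.m_le_inputLength.trans (by omega)
    base_pow_lt := hlt I.base_pow_le (by omega)
    factorial_lt := hlt I.factorial_le (by omega)
    total_lt := hlt (total_le hp) (by omega)
    total_pow_lt := hlt (total_pow_le hp) (by omega)
    mul_total_lt := hlt (mul_total_le hp) (by omega)
    score_lt := hlt I.n_mul_add_scoreDen_mul_scoreDen_le (by omega) }

end ShapInput

/-- SHAP-scores of deterministic and decomposable Boolean circuits under product distributions
with rational marginals can be computed in polynomial time. -/
theorem mainTheorem2 :
    PolyTimeComputableOn ShapInput.encode encodeRat shapInstances ShapInput.score := by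
  refine ⟨ShapProgram.program,
    (ShapProgram.program.timeBound * (Polynomial.X + 1)).comp (10 * Polynomial.X ^ 5),
    fun I hI => ?_⟩
  have hn := I.n_lt_inputLength
  have hle : inputLength I.encode ≤ inputLength I.encode ^ 5 := Nat.le_self_pow (by norm_num) _
  have hmemory (k i : ℕ) : ramInput I.encode k i < 2 ^ (10 * inputLength I.encode ^ 5) :=
    (ramInput_lt_two_pow_inputLength I.encode k i).trans_le
      (Nat.pow_le_pow_right two_pos (by omega))
  obtain ⟨τ, t, hexec, htime, -, hout⟩ :=
    ShapProgram.runs_program hI (ShapInput.fits hI.2.2) (by omega) hmemory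
  exact ⟨τ, t, hexec, by simpa using htime, hout⟩
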